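/- **Definitions.** Let $\mathcal I$ be an ideal on a set $I$ (a family of subsets of $I$ that contains $\emptyset$, is closed under subsets and finite unions, and does not contain $I$), and let $(M_i)_{i\in I}$ be groups. The *reduced product* $\prod_{\mathcal I} M_i$ is the quotient of the group $\prod_{i\in I} M_i$ by the relation $a\sim b \Leftrightarrow \{i : a_i\neq b_i\}\in\mathcal I$. For $S\subseteq I$ let $\pi_S$ be the quotient map from $\prod_{\mathcal I} M_i$ to $\prod_{i\in S} M_i/(\mathcal I\restriction S)$, where $\mathcal I\restriction S=\{A\subseteq S : A\in\mathcal I\}$. Up to a canonical identification, this map depends only on the class of $S$ in the Boolean algebra $\mathcal P(I)/\mathcal I$. An isomorphism $\Phi\colon\prod_{\mathcal I} M_i\to\prod_{\mathcal J} N_j$ between reduced products is *isomorphically coordinate respecting* if there is an isomorphism of Boolean algebras $\alpha\colon\mathcal P(I)/\mathcal I\to\mathcal P(J)/\mathcal J$ such that for every $S\in\mathcal P(I)/\mathcal I$ there is a function $\Phi_S$ from the range of $\pi_S$ to the range of $\pi_{\alpha(S)}$ satisfying $\Phi_S(\pi_S(a))=\pi_{\alpha(S)}(\Phi(a))$ for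 all $a\in\prod_{\mathcal I}M_i$. A class of groups *recognizes coordinates* if every isomorphism between reduced products of groups from the class (over arbitrary index sets and ideals, repetitions allowed) is isomorphically coordinate respecting. A group recognizes coordinates if the class consisting, up to isomorphism, of that group alone does. Let $\Gamma=(V,E)$ be a simple graph, possibly infinite, and let $\mathcal G=(G_v)_{v\in V}$ be a family of groups, possibly infinite. The *graph product* $\Gamma\mathcal G$ is the quotient of the free product $\ast_{v\in V}G_v$ by the normal subgroup generated by the commutators $aba^{-1}b^{-1}$ with $a\in G_v$, $b\in G_w$ and $\{v,w\}\in E$. It is *nontrivial* if $|V|\geq 2$ and $|G_v|\geq 2$ for all $v\in V$. The complement graph of $\Gamma$ is denoted $\bar\Gamma$. **Theorem.** Let $\Gamma\mathcal G$ be a nontrivial graph product such that $|G_v|\geq 3$ for some $v\in V$. Then $\Gamma\mathcal G$ recognizes coordinates if and only if $\bar\Gamma$ is connected. Moreover, the class of all nontrivial graph products $\Gamma\mathcal G$ such that $\bar\Gamma$ is connected and $|G_v|\geq 3$ for some $v\in V$ recognizes coordinates. -/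

import Mathlib

universe u v w

/-! ### The Boolean algebra `𝒫(ι) / 𝓘` -/

/-- Two subsets of `ι` are identified modulo the ideal `𝓘` when their symmetric difference
belongs to `𝓘`. -/
def idealSetoid {ι : Type w} (𝓘 : Order.Ideal (Set ι)) : Setoid (Set ι) where
  r A B := symmDiff A B ∈ 𝓘
  iseqv :=
    { refl := fun A => by rw [symmDiff_self]; exact 𝓘.bot_mem
      symm := fun {A B} h => by rwa [symmDiff_comm]
      trans := fun {A B C} h₁ h₂ =>
        𝓘.lower (symmDiff_triangle A B C) (Order.Ideal.sup_mem h₁ h₂) }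

/-- The quotient `𝒫(ι) / 𝓘` of the power set of `ι` by an ideal `𝓘` of subsets of `ι`. -/
def PowersetMod {ι : Type w} (𝓘 : Order.Ideal (Set ι)) : Type w :=
  Quotient (idealSetoid 𝓘)

namespace PowersetMod

variable {ι : Type w} {𝓘 : Order.Ideal (Set ι)}

/-- The class `[A]` of a subset `A` of `ι` in `𝒫(ι) / 𝓘`. -/
def mk (𝓘 : Order.Ideal (Set ι)) (A : Set ι) : PowersetMod 𝓘 :=
  Quotient.mk (idealSetoid 𝓘) A

theorem ind {p : PowersetMod 𝓘 → Prop} (h : ∀ A, p (mk 𝓘 A)) (x : PowersetMod 𝓘) : p x :=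
  Quotient.inductionOn x h

theorem mk_eq_mk {A B : Set ι} : mk 𝓘 A = mk 𝓘 B ↔ symmDiff A B ∈ 𝓘 :=
  Quotient.eq (r := idealSetoid 𝓘)

theorem mk_eq_mk_iff {A B : Set ι} : mk 𝓘 A = mk 𝓘 B ↔ A \ B ∈ 𝓘 ∧ B \ A ∈ 𝓘 := by
  rw [mk_eq_mk, Set.symmDiff_def]
  exact Order.Ideal.sup_mem_iff

theorem rel_iff {A B : Set ι} : (idealSetoid 𝓘) A B ↔ A \ B ∈ 𝓘 ∧ B \ A ∈ 𝓘 :=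
  (Quotient.eq (r := idealSetoid 𝓘)).symm.trans mk_eq_mk_iff

theorem mem_of_subset_union {A B C : Set ι} (hB : B ∈ 𝓘) (hC : C ∈ 𝓘) (h : A ⊆ B ∪ C) :
    A ∈ 𝓘 :=
  𝓘.lower h (Order.Ideal.sup_mem hB hC)

/-- The order of `𝒫(ι) / 𝓘`: `[A] ≤ [B]` when `A \ B ∈ 𝓘`. -/
instance : LE (PowersetMod 𝓘) where
  le := Quotient.lift₂ (fun A B => A \ B ∈ 𝓘) (by
    intro A B A' B' hA hB
    obtain ⟨hA₁, hA₂⟩ := rel_iff.1 hA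
    obtain ⟨hB₁, hB₂⟩ := rel_iff.1 hB
    refine propext ⟨fun h => ?_, fun h => ?_⟩
    · exact mem_of_subset_union (Order.Ideal.sup_mem hA₂ h) hB₁ (by
        intro x; simp only [Set.sup_eq_union, Set.mem_union, Set.mem_sdiff]; tauto)
    · exact mem_of_subset_union (Order.Ideal.sup_mem hA₁ h) hB₂ (by
        intro x; simp only [Set.sup_eq_union, Set.mem_union, Set.mem_sdiff]; tauto))

theorem mk_le_mk {A B : Set ι} : mk 𝓘 A ≤ mk 𝓘 B ↔ A \ B ∈ 𝓘 := Iff.rfl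

/-- `[A] ⊔ [B] = [A ∪ B]`. -/
instance : Max (PowersetMod 𝓘) where
  max := Quotient.map₂ (fun A B => A ∪ B) (by
    intro A A' hA B B' hB
    obtain ⟨hA₁, hA₂⟩ := rel_iff.1 hA
    obtain ⟨hB₁, hB₂⟩ := rel_iff.1 hB
    refine rel_iff.2 ⟨mem_of_subset_union hA₁ hB₁ ?_, mem_of_subset_union hA₂ hB₂ ?_⟩ <;>
    · intro x; simp only [Set.mem_union, Set.mem_sdiff]; tauto)

/-- `[A] ⊓ [B] = [A ∩ B]`. -/
instance : Min (PowersetMod 𝓘) where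
  min := Quotient.map₂ (fun A B => A ∩ B) (by
    intro A A' hA B B' hB
    obtain ⟨hA₁, hA₂⟩ := rel_iff.1 hA
    obtain ⟨hB₁, hB₂⟩ := rel_iff.1 hB
    refine rel_iff.2 ⟨mem_of_subset_union hA₁ hB₁ ?_, mem_of_subset_union hA₂ hB₂ ?_⟩ <;>
    · intro x; simp only [Set.mem_union, Set.mem_inter_iff, Set.mem_sdiff]; tauto)

/-- `[A]ᶜ = [Aᶜ]`. -/
instance : Compl (PowersetMod 𝓘) where
  compl := Quotient.map (fun A => Aᶜ) (by
    intro A A' hA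
    obtain ⟨hA₁, hA₂⟩ := rel_iff.1 hA
    refine rel_iff.2 ⟨𝓘.lower ?_ hA₂, 𝓘.lower ?_ hA₁⟩ <;>
    · intro x; simp only [Set.mem_compl_iff, Set.mem_sdiff]; tauto)

instance : Top (PowersetMod 𝓘) where
  top := mk 𝓘 Set.univ

instance : Bot (PowersetMod 𝓘) where
  bot := mk 𝓘 ∅

theorem mk_sup_mk (A B : Set ι) : mk 𝓘 A ⊔ mk 𝓘 B = mk 𝓘 (A ∪ B) := rfl

theorem mk_inf_mk (A B : Set ι) : mk 𝓘 A ⊓ mk 𝓘 B = mk 𝓘 (A ∩ B) := rfl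

theorem compl_mk (A : Set ι) : (mk 𝓘 A)ᶜ = mk 𝓘 Aᶜ := rfl

theorem top_def : (⊤ : PowersetMod 𝓘) = mk 𝓘 Set.univ := rfl

theorem bot_def : (⊥ : PowersetMod 𝓘) = mk 𝓘 ∅ := rfl

theorem mk_le_mk_of_subset {A B : Set ι} (h : A ⊆ B) : mk 𝓘 A ≤ mk 𝓘 B :=
  mk_le_mk.2 (by rw [Set.sdiff_eq_empty.2 h]; exact 𝓘.bot_mem)

/-- `𝒫(ι) / 𝓘` is a Boolean algebra, with operations induced by those on subsets of `ι`. -/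
instance : BooleanAlgebra (PowersetMod 𝓘) where
  le_refl x := by
    induction x using ind with | h A => exact mk_le_mk_of_subset subset_rfl
  le_trans x y z := by
    induction x using ind with | h A => ?_
    induction y using ind with | h B => ?_
    induction z using ind with | h C => ?_
    intro h₁ h₂
    exact mk_le_mk.2 (mem_of_subset_union (mk_le_mk.1 h₁) (mk_le_mk.1 h₂) (by
      intro x; simp only [Set.mem_union, Set.mem_sdiff]; tauto))
  le_antisymm x y := by
    induction x using ind with | h A => ?_
    induction y using ind with | h B => ?_
    intro h₁ h₂
    exact mk_eq_mk_iff.2 ⟨mk_le_mk.1 h₁, mk_le_mk.1 h₂⟩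
  sup x y := x ⊔ y
  inf x y := x ⊓ y
  le_sup_left x y := by
    induction x using ind with | h A => ?_
    induction y using ind with | h B => ?_
    exact mk_le_mk_of_subset Set.subset_union_left
  le_sup_right x y := by
    induction x using ind with | h A => ?_
    induction y using ind with | h B => ?_
    exact mk_le_mk_of_subset Set.subset_union_right
  sup_le x y z := by
    induction x using ind with | h A => ?_
    induction y using ind with | h B => ?_
    induction z using ind with | h C => ?_
    intro h₁ h₂
    exact mk_le_mk.2 (mem_of_subset_union (mk_le_mk.1 h₁) (mk_le_mk.1 h₂) (by
      intro x; simp only [Set.mem_union, Set.mem_sdiff]; tauto))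
  inf_le_left x y := by
    induction x using ind with | h A => ?_
    induction y using ind with | h B => ?_
    exact mk_le_mk_of_subset Set.inter_subset_left
  inf_le_right x y := by
    induction x using ind with | h A => ?_
    induction y using ind with | h B => ?_
    exact mk_le_mk_of_subset Set.inter_subset_right
  le_inf x y z := by
    induction x using ind with | h A => ?_
    induction y using ind with | h B => ?_
    induction z using ind with | h C => ?_
    intro h₁ h₂
    exact mk_le_mk.2 (mem_of_subset_union (mk_le_mk.1 h₁) (mk_le_mk.1 h₂) (by
      intro x; simp only [Set.mem_union, Set.mem_inter_iff, Set.mem_sdiff]; tauto))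
  le_sup_inf x y z := by
    induction x using ind with | h A => ?_
    induction y using ind with | h B => ?_
    induction z using ind with | h C => ?_
    exact mk_le_mk_of_subset (by
      intro x; simp only [Set.mem_union, Set.mem_inter_iff]; tauto)
  inf_compl_le_bot x := by
    induction x using ind with | h A => ?_
    exact mk_le_mk_of_subset ((Set.inter_compl_self A).subset)
  top_le_sup_compl x := by
    induction x using ind with | h A => ?_
    exact mk_le_mk_of_subset ((Set.union_compl_self A).superset)
  le_top x := by
    induction x using ind with | h A => exact mk_le_mk_of_subset (Set.subset_univ A)
  bot_le x := by
    induction x using ind with | h A => exact mk_le_mk_of_subset (Set.empty_subset A)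

end PowersetMod

/-! ### Reduced products of groups -/

/-- The congruence on `∏ i, M i` that identifies `a` and `b` when `{i | a i ≠ b i} ∈ 𝓘`. -/
def reducedCon {ι : Type w} (𝓘 : Order.Ideal (Set ι)) (M : ι → Type u) [∀ i, Group (M i)] :
    Con (∀ i, M i) where
  r a b := {i | a i ≠ b i} ∈ 𝓘
  iseqv :=
    { refl := fun a => 𝓘.lower (fun _ hi => (hi rfl).elim) 𝓘.bot_mem
      symm := fun {a b} h => 𝓘.lower (fun i hi => Ne.symm hi) h
      trans := fun {a b c} h₁ h₂ => by
        refine PowersetMod.mem_of_subset_union h₁ h₂ fun i hi => ?_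
        by_contra hn
        simp only [Set.mem_union, Set.mem_ofPred_eq, not_or, not_not] at hn
        exact hi (hn.1.trans hn.2) }
  mul' := fun {a b c d} h₁ h₂ => by
    refine PowersetMod.mem_of_subset_union h₁ h₂ fun i hi => ?_
    by_contra hn
    simp only [Set.mem_union, Set.mem_ofPred_eq, not_or, not_not] at hn
    exact hi (by simp only [Pi.mul_apply, hn.1, hn.2])

/-- The reduced product `∏_𝓘 M i`, that is, the quotient group of the full product `∏ i, M i`
in which `a` and `b` are identified when `{i | a i ≠ b i} ∈ 𝓘`. -/
abbrev ReducedProduct {ι : Type w} (𝓘 : Order.Ideal (Set ι)) (M : ι → Type u)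
    [∀ i, Group (M i)] : Type (max u w) :=
  (reducedCon 𝓘 M).Quotient

/-- The restriction `𝓘 ↾ S` of an ideal on `ι` to a subset `S` of `ι`, as an ideal on `S`: the
subsets of `S` which belong to `𝓘`. -/
def restrictIdeal {ι : Type w} (𝓘 : Order.Ideal (Set ι)) (S : Set ι) : Order.Ideal (Set S) where
  carrier := {A | Subtype.val '' A ∈ 𝓘}
  lower' := fun _ _ hBA hA => 𝓘.lower (Set.image_mono hBA) hA
  nonempty' := ⟨∅, by rw [Set.mem_ofPred_eq, Set.image_empty]; exact 𝓘.bot_mem⟩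
  directed' := fun A hA B hB =>
    ⟨A ∪ B, by
      rw [Set.mem_ofPred_eq, Set.image_union]
      exact Order.Ideal.sup_mem hA hB, Set.subset_union_left, Set.subset_union_right⟩

/-- The group `(∏_𝓘 M i) ↾ S`, that is, the reduced product of `(M i)` for `i ∈ S` with respect to
`𝓘 ↾ S`. -/
abbrev ReducedProductOn {ι : Type w} (𝓘 : Order.Ideal (Set ι)) (M : ι → Type u)
    [∀ i, Group (M i)] (S : Set ι) : Type (max u w) :=
  ReducedProduct (restrictIdeal 𝓘 S) (fun i : S => M i)

/-- The quotient map `π_S` from `∏_𝓘 M i` to `(∏_𝓘 M i) ↾ S`, `[(a i)_i] ↦ [(a i)_{i ∈ S}]`. -/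
def ReducedProduct.proj {ι : Type w} (𝓘 : Order.Ideal (Set ι)) (M : ι → Type u)
    [∀ i, Group (M i)] (S : Set ι) : ReducedProduct 𝓘 M →* ReducedProductOn 𝓘 M S :=
  Con.lift (reducedCon 𝓘 M)
    ((reducedCon (restrictIdeal 𝓘 S) (fun i : S => M i)).mk'.comp
      { toFun := fun a i => a i
        map_one' := rfl
        map_mul' := fun _ _ => rfl })
    (fun a b h => (Con.eq _).2 (𝓘.lower (by rintro _ ⟨i, hi, rfl⟩; exact hi) h))

/-! ### Recognizing coordinates -/

/-- An isomorphism `Φ` from `∏_𝓘 M i` to `∏_𝓙 N j` is isomorphically coordinate respecting if there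
is an isomorphism of Boolean algebras `α : 𝒫(ι) / 𝓘 ≃ 𝒫(κ) / 𝓙` (an order isomorphism between
Boolean algebras is the same thing as an isomorphism of Boolean algebras) such that
`π_S a ↦ π_{α S} (Φ a)` is a well-defined function for every `S` in `𝒫(ι) / 𝓘`. The elements `S` and
`α S` are represented by arbitrary subsets `S` and `T` of the index sets. -/
def IsomorphicallyCoordinateRespecting {ι κ : Type w} (𝓘 : Order.Ideal (Set ι))
    (𝓙 : Order.Ideal (Set κ)) (M : ι → Type u) (N : κ → Type u) [∀ i, Group (M i)]
    [∀ j, Group (N j)] (Φ : ReducedProduct 𝓘 M ≃* ReducedProduct 𝓙 N) : Prop :=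
  ∃ α : PowersetMod 𝓘 ≃o PowersetMod 𝓙,
    ∀ (S : Set ι) (T : Set κ), α (PowersetMod.mk 𝓘 S) = PowersetMod.mk 𝓙 T →
      ∃ ΦS : ReducedProductOn 𝓘 M S → ReducedProductOn 𝓙 N T,
        ∀ a : ReducedProduct 𝓘 M,
          ΦS (ReducedProduct.proj 𝓘 M S a) = ReducedProduct.proj 𝓙 N T (Φ a)

/-- A class `C` of groups recognizes coordinates if every isomorphism between reduced products (over
arbitrary index sets, with respect to arbitrary proper ideals) of groups from `C` is isomorphically
coordinate respecting. -/
def ClassRecognizesCoordinates (C : Set GrpCat.{u}) : Prop :=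
  ∀ (ι κ : Type w) (𝓘 : Order.Ideal (Set ι)) (𝓙 : Order.Ideal (Set κ)),
    Set.univ ∉ 𝓘 → Set.univ ∉ 𝓙 →
    ∀ (M : ι → GrpCat.{u}) (N : κ → GrpCat.{u}), (∀ i, M i ∈ C) → (∀ j, N j ∈ C) →
    ∀ Φ : ReducedProduct 𝓘 (fun i => M i) ≃* ReducedProduct 𝓙 (fun j => N j),
      IsomorphicallyCoordinateRespecting 𝓘 𝓙 (fun i => M i) (fun j => N j) Φ

/-- A group `G` recognizes coordinates if the class consisting of `G` alone (up to isomorphism)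
does. -/
def GroupRecognizesCoordinates (G : Type u) [Group G] : Prop :=
  ClassRecognizesCoordinates.{u, w} {H : GrpCat.{u} | Nonempty (H ≃* G)}

/-! ### Graph products of groups -/

/-- The commutators `a b a⁻¹ b⁻¹`, in the free product of the groups `G x`, of elements `a` of `G x`
and `b` of `G y` for adjacent vertices `x` and `y`. -/
def graphProductRelators {V : Type u} (Γ : SimpleGraph V) (G : V → Type v) [∀ x, Group (G x)] :
    Set (Monoid.CoprodI G) :=
  {g | ∃ (x y : V) (a : G x) (b : G y), Γ.Adj x y ∧
    g = Monoid.CoprodI.of a * Monoid.CoprodI.of b *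
      (Monoid.CoprodI.of a)⁻¹ * (Monoid.CoprodI.of b)⁻¹}

/-- The graph product of the groups `G x` over the graph `Γ`: the quotient of the free product of
the `G x` by the normal subgroup generated by the commutators of elements of groups at adjacent
vertices. The graph and the groups may be infinite. -/
abbrev GraphProduct {V : Type u} (Γ : SimpleGraph V) (G : V → Type v) [∀ x, Group (G x)] :
    Type (max u v) :=
  Monoid.CoprodI G ⧸ Subgroup.normalClosure (graphProductRelators Γ G)

/-- The class of all nontrivial graph products (at least two vertices, all vertex groups nontrivial)
such that the complement of the graph is connected and some vertex group has at least three
elements. -/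
def connectedGraphProducts : Set GrpCat.{max u v} :=
  {H | ∃ (V : Type u) (Γ : SimpleGraph V) (G : V → Type v) (_ : ∀ x, Group (G x)),
    Nontrivial V ∧ (∀ x, Nontrivial (G x)) ∧ (∃ x, 3 ≤ Cardinal.mk (G x)) ∧ Γᶜ.Connected ∧
      Nonempty (H ≃* GraphProduct Γ G)}

/-! Suppose every factor is nontrivial and satisfies `ConjugatesSeparate`. Then two elements of a
reduced product have disjoint supports in `𝒫(ι) / 𝓘` exactly when the first commutes with all
conjugates of the second (`ReducedProduct.disjoint_supp_iff`). This is a group-theoretic condition,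
so an isomorphism `Φ` preserves disjointness of supports. Disjointness determines the order of a
Boolean algebra and every class is a support, so `Φ` induces the isomorphism `α`. Since `π_S x = π_S
y` says that the support of `x⁻¹ * y` is disjoint from `S`, the isomorphism respects coordinates.

It remains to prove `ConjugatesSeparate` for a graph product with connected complement and a vertex
group of order at least 3. By the normal form theorem, the vertices at which a reduced word can
begin depend only on the element it represents. Given `a, b ≠ 1` and vertices `x`, `y` joined in the
complement, conjugate `a` to a reduced word that can begin and end only at `x`, and `b` to one that
can begin and end only at `y` (`exists_isConj_endsAt_empty`). Both concatenations are then reduced;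
one begins at `x`, the other at `y`. If the conjugates commuted, one element would begin at both
vertices, which forces `x` and `y` to be equal or adjacent. The order hypothesis cannot be dropped:
in the infinite dihedral group, a free product of two groups of order 2, rotations commute with all
conjugates of rotations.

Conversely, a disconnected complement splits the graph product as a direct product `P × Q` of
nontrivial groups. Exchanging the `Q`-parts of the two coordinates of its square is an automorphism
that respects no coordinates. -/

/-! ### Groups whose nontrivial normal subgroups have trivial centralizers -/
/-- No nontrivial element commutes with all conjugates of another nontrivial element. -/
def ConjugatesSeparate (G : Type u) [Group G] : Prop :=
  ∀ a b : G, a ≠ 1 → b ≠ 1 → ∃ c : G, ¬ Commute a (c * b * c⁻¹)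

theorem ConjugatesSeparate.of_mulEquiv {G : Type u} {H : Type v} [Group G] [Group H]
    (e : G ≃* H) (h : ConjugatesSeparate H) : ConjugatesSeparate G := by
  intro a b ha hb
  obtain ⟨c, hc⟩ := h (e a) (e b) (by simpa using ha) (by simpa using hb)
  refine ⟨e.symm c, fun hcomm => hc ?_⟩
  simpa using hcomm.map e

/-! ### Supports of elements of reduced products -/

namespace ReducedProduct

variable {ι : Type w} {𝓘 : Order.Ideal (Set ι)} {M : ι → Type u} [∀ i, Group (M i)]

theorem coe_eq_coe {a b : ∀ i, M i} :
    ((a : ReducedProduct 𝓘 M) = b) ↔ {i | a i ≠ b i} ∈ 𝓘 :=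
  Con.eq (reducedCon 𝓘 M)

theorem symmDiff_setOf_ne_one_subset (a b : ∀ i, M i) :
    symmDiff {i | a i ≠ 1} {i | b i ≠ 1} ⊆ {i | a i ≠ b i} := by
  rintro i (⟨h₁, h₂⟩ | ⟨h₁, h₂⟩) h
  · exact h₁ (h.trans (not_not.1 h₂))
  · exact h₁ (h.symm.trans (not_not.1 h₂))

/-- The support `[{i | a i ≠ 1}]` of an element of a reduced product. -/
def supp (x : ReducedProduct 𝓘 M) : PowersetMod 𝓘 :=
  Con.liftOn x (fun a => PowersetMod.mk 𝓘 {i | a i ≠ 1}) fun a b h =>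
    PowersetMod.mk_eq_mk.2 (𝓘.lower (symmDiff_setOf_ne_one_subset a b) h)

theorem supp_coe (a : ∀ i, M i) :
    supp (a : ReducedProduct 𝓘 M) = PowersetMod.mk 𝓘 {i | a i ≠ 1} := rfl

theorem disjoint_mk {A B : Set ι} :
    Disjoint (PowersetMod.mk 𝓘 A) (PowersetMod.mk 𝓘 B) ↔ A ∩ B ∈ 𝓘 := by
  rw [disjoint_iff_inf_le]
  show (A ∩ B) \ ∅ ∈ 𝓘 ↔ A ∩ B ∈ 𝓘
  rw [Set.sdiff_empty]

theorem supp_surjective [∀ i, Nontrivial (M i)] :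
    Function.Surjective (supp : ReducedProduct 𝓘 M → PowersetMod 𝓘) := by
  classical
  intro S
  induction S using PowersetMod.ind with | h A => ?_
  choose g hg using fun i => exists_ne (1 : M i)
  refine ⟨((fun i => if i ∈ A then g i else 1 : ∀ i, M i) : ReducedProduct 𝓘 M), ?_⟩
  rw [supp_coe]
  congr 1
  ext i
  by_cases hi : i ∈ A <;> simp [hi, hg]

/-- Conjugating elements can be chosen independently in each coordinate, so a single `z` witnesses
noncommutation at every coordinate where both elements are nontrivial. -/
theorem disjoint_supp_iff (hM : ∀ i, ConjugatesSeparate (M i)) (x y : ReducedProduct 𝓘 M) :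
    Disjoint (supp x) (supp y) ↔ ∀ z, Commute x (z * y * z⁻¹) := by
  classical
  induction x using Con.induction_on with | H a => ?_
  induction y using Con.induction_on with | H b => ?_
  rw [supp_coe, supp_coe, disjoint_mk]
  constructor
  · intro h z
    induction z using Con.induction_on with | H c => ?_
    refine coe_eq_coe.2 (𝓘.lower (fun i hi => ?_) h)
    refine ⟨fun ha => hi ?_, fun hb => hi ?_⟩
    · simp [ha]
    · simp [hb]
  · intro h
    have key : ∀ i, ∃ c : M i, a i ≠ 1 → b i ≠ 1 → ¬ Commute (a i) (c * b i * c⁻¹) := by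
      intro i
      by_cases ha : a i = 1
      · exact ⟨1, fun h => (h ha).elim⟩
      by_cases hb : b i = 1
      · exact ⟨1, fun _ h => (h hb).elim⟩
      obtain ⟨c, hc⟩ := hM i _ _ ha hb
      exact ⟨c, fun _ _ => hc⟩
    choose c hc using key
    exact 𝓘.lower (fun i hi => hc i hi.1 hi.2) (coe_eq_coe.1 (h (c : ReducedProduct 𝓘 M)))

/-- Expresses the fibres of `π_S` through supports, which is what `α` controls. -/
theorem proj_eq_proj_iff (S : Set ι) (x y : ReducedProduct 𝓘 M) :
    proj 𝓘 M S x = proj 𝓘 M S y ↔ Disjoint (supp (x⁻¹ * y)) (PowersetMod.mk 𝓘 S) := by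
  induction x using Con.induction_on with | H a => ?_
  induction y using Con.induction_on with | H b => ?_
  have h₁ : supp ((a : ReducedProduct 𝓘 M)⁻¹ * (b : ReducedProduct 𝓘 M)) =
      PowersetMod.mk 𝓘 {i | (a⁻¹ * b) i ≠ 1} := rfl
  rw [h₁, disjoint_mk]
  have h₂ : {i | (a⁻¹ * b) i ≠ 1} ∩ S = Subtype.val '' {i : S | a i ≠ b i} := by
    ext i
    simp [inv_mul_eq_one, and_comm]
  rw [h₂]
  exact Con.eq (reducedCon (restrictIdeal 𝓘 S) fun i : S => M i)

end ReducedProduct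

/-! ### Recovering a Boolean algebra from disjointness -/

/-- For the converse, test against an element mapped to the complement of `f b`. -/
theorem le_iff_forall_disjoint {B : Type*} [BooleanAlgebra B] {A : Type*} {f : A → B}
    (hf : Function.Surjective f) (a b : A) :
    f a ≤ f b ↔ ∀ c, Disjoint (f b) (f c) → Disjoint (f a) (f c) := by
  refine ⟨fun h c hc => hc.mono_left h, fun h => ?_⟩
  obtain ⟨c, hc⟩ := hf (f b)ᶜ
  have := h c (hc ▸ disjoint_compl_right)
  rw [hc] at this
  exact disjoint_compl_right_iff.1 this

/-- Both partial orders are the antisymmetrization of the same preorder on `A`. -/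
theorem exists_orderIso_of_surjective {A P Q : Type*} [PartialOrder P] [PartialOrder Q]
    {f : A → P} {g : A → Q} (hf : Function.Surjective f) (hg : Function.Surjective g)
    (h : ∀ a b, f a ≤ f b ↔ g a ≤ g b) : ∃ α : P ≃o Q, ∀ a, α (f a) = g a := by
  have hfg : ∀ a b, f a = f b ↔ g a = g b := fun a b => by
    rw [le_antisymm_iff, le_antisymm_iff, h, h]
  have h₁ : ∀ a, g (Function.surjInv hf (f a)) = g a := fun a =>
    (hfg _ _).1 (Function.surjInv_eq hf _)
  have h₂ : ∀ a, f (Function.surjInv hg (g a)) = f a := fun a =>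
    (hfg _ _).2 (Function.surjInv_eq hg _)
  refine ⟨⟨⟨fun p => g (Function.surjInv hf p), fun q => f (Function.surjInv hg q), ?_, ?_⟩, ?_⟩,
    h₁⟩
  · intro p
    obtain ⟨a, rfl⟩ := hf p
    exact (congrArg (fun q => f (Function.surjInv hg q)) (h₁ a)).trans (h₂ a)
  · intro q
    obtain ⟨a, rfl⟩ := hg q
    exact (congrArg (fun p => g (Function.surjInv hf p)) (h₂ a)).trans (h₁ a)
  · intro p q
    obtain ⟨a, rfl⟩ := hf p
    obtain ⟨b, rfl⟩ := hf q
    simp only [Equiv.coe_fn_mk, h₁, h]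

theorem isomorphicallyCoordinateRespecting_of_conjugatesSeparate {ι κ : Type w}
    {𝓘 : Order.Ideal (Set ι)} {𝓙 : Order.Ideal (Set κ)} {M : ι → Type u} {N : κ → Type u}
    [∀ i, Group (M i)] [∀ j, Group (N j)] [∀ i, Nontrivial (M i)] [∀ j, Nontrivial (N j)]
    (hM : ∀ i, ConjugatesSeparate (M i)) (hN : ∀ j, ConjugatesSeparate (N j))
    (Φ : ReducedProduct 𝓘 M ≃* ReducedProduct 𝓙 N) :
    IsomorphicallyCoordinateRespecting 𝓘 𝓙 M N Φ := by
  have hg : Function.Surjective fun x => ReducedProduct.supp (Φ x) :=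
    ReducedProduct.supp_surjective.comp Φ.surjective
  have hdisj : ∀ x y, Disjoint (ReducedProduct.supp x) (ReducedProduct.supp y) ↔
      Disjoint (ReducedProduct.supp (Φ x)) (ReducedProduct.supp (Φ y)) := by
    intro x y
    rw [ReducedProduct.disjoint_supp_iff hM, ReducedProduct.disjoint_supp_iff hN,
      Φ.surjective.forall]
    refine forall_congr' fun z => ?_
    rw [← map_inv, ← map_mul, ← map_mul]
    exact (commute_map_iff Φ.injective).symm
  obtain ⟨α, hα⟩ := exists_orderIso_of_surjective
    (f := ReducedProduct.supp (𝓘 := 𝓘) (M := M)) ReducedProduct.supp_surjective hg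
    fun x y => by
      rw [le_iff_forall_disjoint ReducedProduct.supp_surjective,
        le_iff_forall_disjoint (f := fun x => ReducedProduct.supp (Φ x)) hg]
      exact forall_congr' fun z => by rw [hdisj, hdisj]
  refine ⟨α, fun S T hST => ?_⟩
  have hfac : Function.FactorsThrough (fun x => ReducedProduct.proj 𝓙 N T (Φ x))
      (ReducedProduct.proj 𝓘 M S) := by
    intro x y hxy
    rw [ReducedProduct.proj_eq_proj_iff] at hxy
    show ReducedProduct.proj 𝓙 N T (Φ x) = ReducedProduct.proj 𝓙 N T (Φ y)
    rw [ReducedProduct.proj_eq_proj_iff, ← map_inv, ← map_mul, ← hα, ← hST]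
    exact (disjoint_map_orderIso_iff α).2 hxy
  -- The default value `1` is irrelevant: only values on the range of `π_S` are constrained.
  exact ⟨Function.extend (ReducedProduct.proj 𝓘 M S)
    (fun x => ReducedProduct.proj 𝓙 N T (Φ x)) 1, fun x => hfac.extend_apply 1 x⟩

/-! ### Reduced words in graph products -/

namespace GraphProduct

open scoped Classical in
/-- The coefficient in `G x` of the syllable at `x` that can be shuffled to the front of a word, or
`1` if there is none. -/
noncomputable def headCoeff {V : Type u} (Γ : SimpleGraph V) {G : V → Type v} [∀ x, Group (G x)]
    (x : V) : List (Σ y, G y) → G x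
  | [] => 1
  | s :: l => if h : s.1 = x then h ▸ s.2 else if Γ.Adj x s.1 then headCoeff Γ x l else 1

open scoped Classical in
/-- Delete from a word the syllable at `x` that can be shuffled to the front, if there is one. -/
noncomputable def removeHead {V : Type u} (Γ : SimpleGraph V) {G : V → Type v}
    (x : V) : List (Σ y, G y) → List (Σ y, G y)
  | [] => []
  | s :: l => if s.1 = x then l else if Γ.Adj x s.1 then s :: removeHead Γ x l else s :: l

/-- A word is reduced if its syllables are nontrivial and no two of them can be merged. -/
def Reduced {V : Type u} (Γ : SimpleGraph V) {G : V → Type v} [∀ x, Group (G x)] :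
    List (Σ y, G y) → Prop
  | [] => True
  | s :: l => s.2 ≠ 1 ∧ headCoeff Γ s.1 l = 1 ∧ Reduced Γ l

open scoped Classical in
/-- Prepend the syllable `g` to a word if it is nontrivial. -/
noncomputable def consSyllable {V : Type u} {G : V → Type v} [∀ x, Group (G x)]
    {x : V} (g : G x) (l : List (Σ y, G y)) : List (Σ y, G y) :=
  if g = 1 then l else ⟨x, g⟩ :: l

/-- Two words are shuffles of each other. -/
inductive Shuffle {V : Type u} (Γ : SimpleGraph V) {G : V → Type v} :
    List (Σ y, G y) → List (Σ y, G y) → Prop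
  | refl (l) : Shuffle Γ l l
  | cons (s) {l l'} : Shuffle Γ l l' → Shuffle Γ (s :: l) (s :: l')
  | swap (s t l) : Γ.Adj s.1 t.1 → Shuffle Γ (s :: t :: l) (t :: s :: l)
  | trans {l l' l''} : Shuffle Γ l l' → Shuffle Γ l' l'' → Shuffle Γ l l''

variable {V : Type u} {Γ : SimpleGraph V} {G : V → Type v}

theorem Shuffle.symm {l l' : List (Σ y, G y)} (h : Shuffle Γ l l') : Shuffle Γ l' l := by
  induction h with
  | refl l => exact .refl l
  | cons s _ ih => exact .cons s ih
  | swap s t l h => exact .swap t s l h.symm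
  | trans _ _ ih₁ ih₂ => exact .trans ih₂ ih₁

section removeHead

theorem removeHead_cons_self (x : V) (g : G x) (l : List (Σ y, G y)) :
    removeHead Γ x (⟨x, g⟩ :: l) = l := by
  simp [removeHead]

theorem removeHead_cons_adj {x : V} {s : Σ y, G y} (h : Γ.Adj x s.1) (l : List (Σ y, G y)) :
    removeHead Γ x (s :: l) = s :: removeHead Γ x l := by
  simp [removeHead, h, h.ne']

theorem removeHead_cons_of_not {x : V} {s : Σ y, G y} (h : s.1 ≠ x) (h' : ¬ Γ.Adj x s.1)
    (l : List (Σ y, G y)) : removeHead Γ x (s :: l) = s :: l := by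
  simp [removeHead, h, h']

theorem removeHead_comm {x y : V} (hxy : Γ.Adj x y) (l : List (Σ y, G y)) :
    removeHead Γ x (removeHead Γ y l) = removeHead Γ y (removeHead Γ x l) := by
  induction l with
  | nil => rfl
  | cons s l ih =>
    obtain ⟨z, g⟩ := s
    by_cases hx : z = x
    · subst hx
      rw [removeHead_cons_adj hxy.symm, removeHead_cons_self, removeHead_cons_self]
    by_cases hy : z = y
    · subst hy
      rw [removeHead_cons_self, removeHead_cons_adj (s := ⟨z, g⟩) hxy, removeHead_cons_self]
    by_cases hx' : Γ.Adj x z <;> by_cases hy' : Γ.Adj y z <;>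
      simp [removeHead, hx, hy, hx', hy', ih]

theorem Shuffle.removeHead (x : V) {l l' : List (Σ y, G y)} (h : Shuffle Γ l l') :
    Shuffle Γ (removeHead Γ x l) (removeHead Γ x l') := by
  induction h with
  | refl l => exact .refl _
  | @cons s l l' h ih =>
    obtain ⟨y, g⟩ := s
    by_cases hy : y = x
    · subst hy
      rwa [removeHead_cons_self, removeHead_cons_self]
    by_cases hy' : Γ.Adj x y
    · rw [removeHead_cons_adj hy', removeHead_cons_adj hy']
      exact .cons _ ih
    · rw [removeHead_cons_of_not hy hy', removeHead_cons_of_not hy hy']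
      exact .cons _ h
  | swap s t l h =>
    obtain ⟨y, g⟩ := s
    obtain ⟨z, k⟩ := t
    by_cases hy : y = x
    · subst hy
      rw [removeHead_cons_self, removeHead_cons_adj h, removeHead_cons_self]
      exact .refl _
    by_cases hz : z = x
    · subst hz
      rw [removeHead_cons_self, removeHead_cons_adj h.symm, removeHead_cons_self]
      exact .refl _
    by_cases hy' : Γ.Adj x y <;> by_cases hz' : Γ.Adj x z <;>
      simp only [GraphProduct.removeHead, hy, hz, hy', hz', if_true, if_false] <;>
      exact .swap _ _ _ h
  | trans _ _ ih₁ ih₂ => exact .trans ih₁ ih₂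

end removeHead

variable [∀ x, Group (G x)]

theorem headCoeff_nil (x : V) : headCoeff Γ x ([] : List (Σ y, G y)) = 1 := rfl

theorem headCoeff_cons_self (x : V) (g : G x) (l : List (Σ y, G y)) :
    headCoeff Γ x (⟨x, g⟩ :: l) = g := by
  simp [headCoeff]

theorem headCoeff_cons_adj {x : V} {s : Σ y, G y} (h : Γ.Adj x s.1) (l : List (Σ y, G y)) :
    headCoeff Γ x (s :: l) = headCoeff Γ x l := by
  simp [headCoeff, h, h.ne']

theorem headCoeff_cons_of_not {x : V} {s : Σ y, G y} (h : s.1 ≠ x) (h' : ¬ Γ.Adj x s.1)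
    (l : List (Σ y, G y)) : headCoeff Γ x (s :: l) = 1 := by
  simp [headCoeff, h, h']

theorem Shuffle.headCoeff (x : V) {l l' : List (Σ y, G y)} (h : Shuffle Γ l l') :
    headCoeff Γ x l = headCoeff Γ x l' := by
  induction h with
  | refl l => rfl
  | cons s h ih => simp only [GraphProduct.headCoeff, ih]
  | swap s t l h =>
    obtain ⟨y, g⟩ := s
    obtain ⟨z, k⟩ := t
    by_cases hy : y = x
    · subst hy
      rw [headCoeff_cons_self, headCoeff_cons_adj h, headCoeff_cons_self]
    by_cases hz : z = x
    · subst hz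
      rw [headCoeff_cons_self, headCoeff_cons_adj h.symm, headCoeff_cons_self]
    by_cases hy' : Γ.Adj x y <;> by_cases hz' : Γ.Adj x z <;>
      simp [GraphProduct.headCoeff, hy, hz, hy', hz']
  | trans _ _ ih₁ ih₂ => exact ih₁.trans ih₂

theorem reduced_cons {s : Σ y, G y} {l : List (Σ y, G y)} :
    Reduced Γ (s :: l) ↔ s.2 ≠ 1 ∧ headCoeff Γ s.1 l = 1 ∧ Reduced Γ l := Iff.rfl

/-- A second syllable at `x` reaching the front would be mergeable with the first one. -/
theorem Reduced.headCoeff_removeHead {l : List (Σ y, G y)} (hl : Reduced Γ l) (x : V) :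
    headCoeff Γ x (removeHead Γ x l) = 1 := by
  induction l with
  | nil => rfl
  | cons s l ih =>
    obtain ⟨y, g⟩ := s
    obtain ⟨-, hy, hl⟩ := hl
    by_cases h : y = x
    · subst h
      rwa [removeHead_cons_self]
    by_cases h' : Γ.Adj x y
    · rw [removeHead_cons_adj h', headCoeff_cons_adj h', ih hl]
    · rw [removeHead_cons_of_not h h', headCoeff_cons_of_not h h']

theorem headCoeff_removeHead_of_adj {x y : V} (h : Γ.Adj x y) (l : List (Σ y, G y)) :
    headCoeff Γ x (removeHead Γ y l) = headCoeff Γ x l := by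
  induction l with
  | nil => rfl
  | cons s l ih =>
    obtain ⟨z, g⟩ := s
    by_cases hz : z = y
    · subst hz
      rw [removeHead_cons_self, headCoeff_cons_adj h]
    by_cases hz' : Γ.Adj y z
    · rw [removeHead_cons_adj hz']
      simp only [headCoeff, ih]
    · rw [removeHead_cons_of_not hz hz']

theorem Reduced.removeHead {l : List (Σ y, G y)} (hl : Reduced Γ l) (x : V) :
    Reduced Γ (removeHead Γ x l) := by
  induction l with
  | nil => exact hl
  | cons s l ih =>
    obtain ⟨y, g⟩ := s
    obtain ⟨hg, hy, hl⟩ := hl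
    by_cases h : y = x
    · subst h
      rwa [removeHead_cons_self]
    by_cases h' : Γ.Adj x y
    · rw [removeHead_cons_adj h']
      exact ⟨hg, (headCoeff_removeHead_of_adj h'.symm l).trans hy, ih hl⟩
    · rw [removeHead_cons_of_not h h']
      exact ⟨hg, hy, hl⟩

/-- Reducedness excludes a trivial syllable at `x`, which has coefficient `1` but would still be
deleted. -/
theorem removeHead_eq_self {l : List (Σ y, G y)} (hl : Reduced Γ l) {x : V}
    (hx : headCoeff Γ x l = 1) : removeHead Γ x l = l := by
  induction l with
  | nil => rfl
  | cons s l ih =>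
    obtain ⟨y, g⟩ := s
    by_cases h : y = x
    · subst h
      rw [headCoeff_cons_self] at hx
      exact (hl.1 hx).elim
    by_cases h' : Γ.Adj x y
    · rw [headCoeff_cons_adj h'] at hx
      rw [removeHead_cons_adj h', ih hl.2.2 hx]
    · rw [removeHead_cons_of_not h h']

theorem consSyllable_one {x : V} (l : List (Σ y, G y)) : consSyllable (1 : G x) l = l :=
  if_pos rfl

theorem consSyllable_of_ne_one {x : V} {g : G x} (hg : g ≠ 1) (l : List (Σ y, G y)) :
    consSyllable g l = ⟨x, g⟩ :: l :=
  if_neg hg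

theorem headCoeff_consSyllable {x : V} (g : G x) {l : List (Σ y, G y)}
    (hl : headCoeff Γ x l = 1) : headCoeff Γ x (consSyllable g l) = g := by
  by_cases hg : g = 1
  · subst hg
    rw [consSyllable_one, hl]
  · rw [consSyllable_of_ne_one hg, headCoeff_cons_self]

theorem headCoeff_consSyllable_of_adj {x y : V} (h : Γ.Adj x y) (g : G y) (l : List (Σ y, G y)) :
    headCoeff Γ x (consSyllable g l) = headCoeff Γ x l := by
  by_cases hg : g = 1
  · subst hg
    rw [consSyllable_one]
  · rw [consSyllable_of_ne_one hg, headCoeff_cons_adj h]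

theorem removeHead_consSyllable {x : V} (g : G x) {l : List (Σ y, G y)} (hl : Reduced Γ l)
    (hx : headCoeff Γ x l = 1) : removeHead Γ x (consSyllable g l) = l := by
  by_cases hg : g = 1
  · subst hg
    rw [consSyllable_one, removeHead_eq_self hl hx]
  · rw [consSyllable_of_ne_one hg, removeHead_cons_self]

theorem removeHead_consSyllable_of_adj {x y : V} (h : Γ.Adj x y) (g : G y)
    (l : List (Σ y, G y)) :
    removeHead Γ x (consSyllable g l) = consSyllable g (removeHead Γ x l) := by
  by_cases hg : g = 1
  · subst hg
    rw [consSyllable_one, consSyllable_one]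
  · rw [consSyllable_of_ne_one hg, consSyllable_of_ne_one hg, removeHead_cons_adj h]

theorem Reduced.consSyllable {x : V} (g : G x) {l : List (Σ y, G y)} (hl : Reduced Γ l)
    (hx : headCoeff Γ x l = 1) : Reduced Γ (consSyllable g l) := by
  by_cases hg : g = 1
  · subst hg
    rwa [consSyllable_one]
  · rw [consSyllable_of_ne_one hg]
    exact ⟨hg, hx, hl⟩

theorem Shuffle.consSyllable {x : V} (g : G x) {l l' : List (Σ y, G y)} (h : Shuffle Γ l l') :
    Shuffle Γ (consSyllable g l) (consSyllable g l') := by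
  by_cases hg : g = 1
  · subst hg
    rwa [consSyllable_one, consSyllable_one]
  · rw [consSyllable_of_ne_one hg, consSyllable_of_ne_one hg]
    exact .cons _ h

theorem shuffle_consSyllable_comm {x y : V} (h : Γ.Adj x y) (g : G x) (k : G y)
    (l : List (Σ y, G y)) :
    Shuffle Γ (consSyllable g (consSyllable k l)) (consSyllable k (consSyllable g l)) := by
  by_cases hg : g = 1
  · subst hg
    rw [consSyllable_one, consSyllable_one]
    exact .refl _
  by_cases hk : k = 1
  · subst hk
    rw [consSyllable_one, consSyllable_one]
    exact .refl _
  simp only [consSyllable_of_ne_one hg, consSyllable_of_ne_one hk]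
  exact .swap _ _ _ h

theorem Reduced.shuffle_consSyllable_removeHead {l : List (Σ y, G y)} (hl : Reduced Γ l) (x : V) :
    Shuffle Γ (GraphProduct.consSyllable (headCoeff Γ x l) (GraphProduct.removeHead Γ x l)) l := by
  induction l with
  | nil =>
    rw [headCoeff_nil, consSyllable_one]
    exact .refl _
  | cons s l ih =>
    obtain ⟨y, g⟩ := s
    by_cases h : y = x
    · subst h
      rw [headCoeff_cons_self, removeHead_cons_self, consSyllable_of_ne_one hl.1]
      exact .refl _
    by_cases h' : Γ.Adj x y
    · rw [headCoeff_cons_adj h', removeHead_cons_adj h', ← consSyllable_of_ne_one hl.1,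
        ← consSyllable_of_ne_one hl.1]
      refine (shuffle_consSyllable_comm h' _ _ _).trans ?_
      exact (ih hl.2.2).consSyllable g
    · rw [headCoeff_cons_of_not h h', removeHead_cons_of_not h h', consSyllable_one]
      exact .refl _

/-! ### The action of a graph product on its reduced words up to shuffling -/

/-- The product of a vertex group element and a reduced word. -/
noncomputable def mulWord {x : V} (Γ : SimpleGraph V) (g : G x) (l : List (Σ y, G y)) :
    List (Σ y, G y) :=
  consSyllable (g * headCoeff Γ x l) (removeHead Γ x l)

theorem Reduced.mulWord {x : V} (g : G x) {l : List (Σ y, G y)} (hl : Reduced Γ l) :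
    Reduced Γ (mulWord Γ g l) :=
  (hl.removeHead x).consSyllable _ (hl.headCoeff_removeHead x)

theorem Shuffle.mulWord {x : V} (g : G x) {l l' : List (Σ y, G y)} (h : Shuffle Γ l l') :
    Shuffle Γ (mulWord Γ g l) (mulWord Γ g l') := by
  rw [GraphProduct.mulWord, GraphProduct.mulWord, h.headCoeff x]
  exact (h.removeHead x).consSyllable _

/-- This holds on the nose, whereas multiplying by `1` may move a syllable to the front. Hence the
action lives on shuffle classes. -/
theorem Reduced.mulWord_mul {x : V} (g k : G x) {l : List (Σ y, G y)} (hl : Reduced Γ l) :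
    GraphProduct.mulWord Γ (g * k) l =
      GraphProduct.mulWord Γ g (GraphProduct.mulWord Γ k l) := by
  simp only [GraphProduct.mulWord]
  rw [headCoeff_consSyllable _ (hl.headCoeff_removeHead x),
    removeHead_consSyllable _ (hl.removeHead x) (hl.headCoeff_removeHead x), mul_assoc]

theorem Reduced.shuffle_mulWord_one {l : List (Σ y, G y)} (hl : Reduced Γ l) (x : V) :
    Shuffle Γ (GraphProduct.mulWord Γ (1 : G x) l) l := by
  rw [GraphProduct.mulWord, one_mul]
  exact hl.shuffle_consSyllable_removeHead x

theorem shuffle_mulWord_comm {x y : V} (h : Γ.Adj x y) (g : G x) (k : G y)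
    (l : List (Σ y, G y)) :
    Shuffle Γ (mulWord Γ g (mulWord Γ k l)) (mulWord Γ k (mulWord Γ g l)) := by
  simp only [mulWord]
  rw [headCoeff_consSyllable_of_adj h, headCoeff_consSyllable_of_adj h.symm,
    removeHead_consSyllable_of_adj h, removeHead_consSyllable_of_adj h.symm,
    headCoeff_removeHead_of_adj h, headCoeff_removeHead_of_adj h.symm, removeHead_comm h]
  exact shuffle_consSyllable_comm h _ _ _

/-- Reduced words are identified when they are shuffles of each other. -/
instance wordSetoid (Γ : SimpleGraph V) (G : V → Type v) [∀ x, Group (G x)] :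
    Setoid {l : List (Σ y, G y) // Reduced Γ l} where
  r l l' := Shuffle Γ l.1 l'.1
  iseqv := ⟨fun _ => .refl _, Shuffle.symm, Shuffle.trans⟩

/-- Reduced words up to shuffling. -/
abbrev WordClass (Γ : SimpleGraph V) (G : V → Type v) [∀ x, Group (G x)] : Type (max u v) :=
  Quotient (wordSetoid Γ G)

/-- The action of a vertex group on classes of reduced words. -/
noncomputable def vertexAction (Γ : SimpleGraph V) (G : V → Type v) [∀ x, Group (G x)] (x : V) :
    G x →* Equiv.Perm (WordClass Γ G) :=
  MonoidHom.toHomPerm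
    { toFun := fun g => Quotient.map (fun l => ⟨mulWord Γ g l.1, l.2.mulWord g⟩)
        fun _ _ h => Shuffle.mulWord g h
      map_one' := by
        funext c
        induction c using Quotient.inductionOn with | h l => ?_
        exact Quotient.sound (l.2.shuffle_mulWord_one x)
      map_mul' := fun g k => by
        funext c
        induction c using Quotient.inductionOn with | h l => ?_
        exact congrArg _ (Subtype.ext (l.2.mulWord_mul g k)) }

theorem vertexAction_mk {x : V} (g : G x) (l : {l : List (Σ y, G y) // Reduced Γ l}) :
    vertexAction Γ G x g (Quotient.mk _ l) = Quotient.mk _ ⟨mulWord Γ g l.1, l.2.mulWord g⟩ :=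
  rfl

/-- The homomorphism from a graph product defined by homomorphisms from the vertex groups whose
images commute for adjacent vertices. -/
noncomputable def lift {H : Type*} [Group H] (f : ∀ x, G x →* H)
    (hf : ∀ x y, Γ.Adj x y → ∀ (a : G x) (b : G y), Commute (f x a) (f y b)) :
    GraphProduct Γ G →* H :=
  QuotientGroup.lift _ (Monoid.CoprodI.lift f) <| by
    refine Subgroup.normalClosure_le_normal ?_
    rintro _ ⟨x, y, a, b, h, rfl⟩
    simp only [SetLike.mem_coe, MonoidHom.mem_ker, map_mul, map_inv, Monoid.CoprodI.lift_of]
    rw [(hf x y h a b).eq]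
    group

/-- The inclusion of a vertex group into a graph product. -/
def of (Γ : SimpleGraph V) {G : V → Type v} [∀ x, Group (G x)] {x : V} :
    G x →* GraphProduct Γ G :=
  (QuotientGroup.mk' _).comp Monoid.CoprodI.of

theorem lift_of {H : Type*} [Group H] (f : ∀ x, G x →* H)
    (hf : ∀ x y, Γ.Adj x y → ∀ (a : G x) (b : G y), Commute (f x a) (f y b)) {x : V} (g : G x) :
    lift f hf (of Γ g) = f x g :=
  Monoid.CoprodI.lift_of f g

theorem commute_of {x y : V} (h : Γ.Adj x y) (a : G x) (b : G y) :
    Commute (of Γ a) (of Γ b) := by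
  have : of Γ a * of Γ b * (of Γ a)⁻¹ * (of Γ b)⁻¹ = 1 :=
    (QuotientGroup.eq_one_iff _).2 (Subgroup.subset_normalClosure ⟨x, y, a, b, h, rfl⟩)
  rwa [mul_inv_eq_one, mul_inv_eq_iff_eq_mul] at this

theorem induction_left {p : GraphProduct Γ G → Prop} (g : GraphProduct Γ G) (one : p 1)
    (of_mul : ∀ (x : V) (a : G x) (g : GraphProduct Γ G), p g → p (of Γ a * g)) : p g := by
  obtain ⟨g, rfl⟩ := QuotientGroup.mk_surjective g
  induction g using Monoid.CoprodI.induction_left with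
  | one => exact one
  | mul a g ih => exact of_mul _ a _ ih

/-- The element of a graph product represented by a word. -/
def wordProd (Γ : SimpleGraph V) {G : V → Type v} [∀ x, Group (G x)] (l : List (Σ y, G y)) :
    GraphProduct Γ G :=
  (l.map fun s => of Γ s.2).prod

theorem wordProd_nil : wordProd Γ ([] : List (Σ y, G y)) = 1 := rfl

theorem wordProd_cons (s : Σ y, G y) (l : List (Σ y, G y)) :
    wordProd Γ (s :: l) = of Γ s.2 * wordProd Γ l := by
  simp [wordProd]

theorem wordProd_append (l l' : List (Σ y, G y)) :
    wordProd Γ (l ++ l') = wordProd Γ l * wordProd Γ l' := by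
  simp [wordProd]

theorem wordProd_consSyllable {x : V} (g : G x) (l : List (Σ y, G y)) :
    wordProd Γ (consSyllable g l) = of Γ g * wordProd Γ l := by
  by_cases hg : g = 1
  · subst hg
    rw [consSyllable_one, map_one, one_mul]
  · rw [consSyllable_of_ne_one hg, wordProd_cons]

theorem Shuffle.wordProd_eq {l l' : List (Σ y, G y)} (h : Shuffle Γ l l') :
    wordProd Γ l = wordProd Γ l' := by
  induction h with
  | refl l => rfl
  | cons s _ ih => rw [wordProd_cons, wordProd_cons, ih]
  | swap s t l h =>
    simp only [wordProd_cons, ← mul_assoc]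
    rw [(commute_of h s.2 t.2).eq]
  | trans _ _ ih₁ ih₂ => exact ih₁.trans ih₂

theorem Reduced.wordProd_mulWord {x : V} (g : G x) {l : List (Σ y, G y)} (hl : Reduced Γ l) :
    wordProd Γ (GraphProduct.mulWord Γ g l) = of Γ g * wordProd Γ l := by
  rw [GraphProduct.mulWord, wordProd_consSyllable, map_mul, mul_assoc, ← wordProd_consSyllable,
    (hl.shuffle_consSyllable_removeHead x).wordProd_eq]

theorem exists_reduced (g : GraphProduct Γ G) : ∃ l, Reduced Γ l ∧ wordProd Γ l = g := by
  induction g using induction_left with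
  | one => exact ⟨[], trivial, rfl⟩
  | of_mul x a g ih =>
    obtain ⟨l, hl, rfl⟩ := ih
    exact ⟨mulWord Γ a l, hl.mulWord a, hl.wordProd_mulWord a⟩

theorem commute_vertexAction {x y : V} (h : Γ.Adj x y) (a : G x) (b : G y) :
    Commute (vertexAction Γ G x a) (vertexAction Γ G y b) :=
  Equiv.ext fun c => by
    induction c using Quotient.inductionOn with | h l => ?_
    exact Quotient.sound (shuffle_mulWord_comm h a b l.1)

/-- The action of a graph product on classes of reduced words. -/
noncomputable def wordAction (Γ : SimpleGraph V) (G : V → Type v) [∀ x, Group (G x)] :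
    GraphProduct Γ G →* Equiv.Perm (WordClass Γ G) :=
  lift (vertexAction Γ G) fun _ _ h a b => commute_vertexAction h a b

theorem wordAction_of {x : V} (g : G x) : wordAction Γ G (of Γ g) = vertexAction Γ G x g :=
  lift_of _ _ g

theorem Reduced.mulWord_eq_cons {x : V} {g : G x} {l : List (Σ y, G y)} (hl : Reduced Γ l)
    (hg : g ≠ 1) (hx : headCoeff Γ x l = 1) : GraphProduct.mulWord Γ g l = ⟨x, g⟩ :: l := by
  rw [GraphProduct.mulWord, hx, mul_one, removeHead_eq_self hl hx, consSyllable_of_ne_one hg]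

/-- The normal form theorem: acting on the empty word rebuilds a reduced word syllable by syllable,
so its shuffle class is determined by the element. -/
theorem Reduced.wordAction_wordProd {l : List (Σ y, G y)} (hl : Reduced Γ l) :
    wordAction Γ G (wordProd Γ l) (Quotient.mk _ ⟨[], trivial⟩) = Quotient.mk _ ⟨l, hl⟩ := by
  induction l with
  | nil => rfl
  | cons s l ih =>
    obtain ⟨hg, hx, hl'⟩ := reduced_cons.1 hl
    rw [wordProd_cons, map_mul, Equiv.Perm.mul_apply, ih hl', wordAction_of, vertexAction_mk]
    exact congrArg _ (Subtype.ext (hl'.mulWord_eq_cons hg hx))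

theorem Reduced.headCoeff_eq_of_wordProd_eq {l l' : List (Σ y, G y)} (hl : Reduced Γ l)
    (hl' : Reduced Γ l') (h : wordProd Γ l = wordProd Γ l') (x : V) :
    headCoeff Γ x l = headCoeff Γ x l' := by
  have h₁ := hl.wordAction_wordProd
  rw [h, hl'.wordAction_wordProd] at h₁
  exact (Shuffle.headCoeff x (Quotient.exact h₁)).symm

theorem of_ne_one {x : V} {g : G x} (hg : g ≠ 1) : of Γ g ≠ 1 := by
  intro h
  have hr : Reduced Γ [(⟨x, g⟩ : Σ y, G y)] := ⟨hg, rfl, trivial⟩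
  have := hr.headCoeff_eq_of_wordProd_eq (l' := []) trivial
    (by rw [wordProd_cons, h, wordProd_nil, one_mul]) x
  rw [headCoeff_cons_self] at this
  exact hg this

end GraphProduct

/-! ### Conjugates of reduced words in graph products -/

theorem List.reverse_cons_append_singleton {α : Type*} (s t : α) (l : List α) :
    (s :: (l ++ [t])).reverse = t :: (l.reverse ++ [s]) := by
  simp

namespace GraphProduct

variable {V : Type u} {Γ : SimpleGraph V} {G : V → Type v} [∀ x, Group (G x)]

theorem headCoeff_append_of_forall_adj {x : V} {l : List (Σ y, G y)}
    (h : ∀ s ∈ l, Γ.Adj x s.1) (l' : List (Σ y, G y)) :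
    headCoeff Γ x (l ++ l') = headCoeff Γ x l' := by
  induction l with
  | nil => rfl
  | cons s l ih =>
    rw [List.cons_append, headCoeff_cons_adj (h s List.mem_cons_self),
      ih fun t ht => h t (List.mem_cons_of_mem s ht)]

/-- The search for a syllable at `x` stops inside `l`, either at such a syllable or at one that
blocks it; `Γ.Adj x s.1` fails in both cases. -/
theorem headCoeff_append_of_not_forall_adj {x : V} {l : List (Σ y, G y)}
    (h : ¬ ∀ s ∈ l, Γ.Adj x s.1) (l' : List (Σ y, G y)) :
    headCoeff Γ x (l ++ l') = headCoeff Γ x l := by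
  induction l with
  | nil => simp at h
  | cons s l ih =>
    by_cases hs : Γ.Adj x s.1
    · rw [List.cons_append, headCoeff_cons_adj hs, headCoeff_cons_adj hs, ih]
      simpa [hs] using h
    · simp only [List.cons_append, headCoeff, hs, if_false]

theorem headCoeff_eq_one_of_forall_adj {x : V} {l : List (Σ y, G y)}
    (h : ∀ s ∈ l, Γ.Adj x s.1) : headCoeff Γ x l = 1 := by
  simpa [headCoeff_nil] using headCoeff_append_of_forall_adj h []

theorem headCoeff_eq_one_of_forall_ne {x : V} {l : List (Σ y, G y)} (h : ∀ s ∈ l, s.1 ≠ x) :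
    headCoeff Γ x l = 1 := by
  induction l with
  | nil => rfl
  | cons s l ih =>
    simp only [headCoeff, h s List.mem_cons_self, dif_neg, not_false_eq_true,
      ih fun t ht => h t (List.mem_cons_of_mem s ht), ite_self]

theorem exists_mem_of_headCoeff_ne_one {x : V} {l : List (Σ y, G y)}
    (h : headCoeff Γ x l ≠ 1) : ∃ s ∈ l, s.1 = x := by
  by_contra! hn
  exact h (headCoeff_eq_one_of_forall_ne hn)

/-- Of two syllables that both reach the front, the later one must pass the earlier one. -/
theorem eq_or_adj_of_headCoeff_ne_one {x y : V} {l : List (Σ y, G y)}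
    (hx : headCoeff Γ x l ≠ 1) (hy : headCoeff Γ y l ≠ 1) : x = y ∨ Γ.Adj x y := by
  induction l with
  | nil => exact (hx rfl).elim
  | cons s l ih =>
    obtain ⟨z, g⟩ := s
    by_cases hxz : z = x
    · subst hxz
      by_contra! hn
      exact hy (headCoeff_cons_of_not hn.1 (fun h => hn.2 h.symm) l)
    by_cases hyz : z = y
    · subst hyz
      by_contra! hn
      exact hx (headCoeff_cons_of_not hxz hn.2 l)
    by_cases hx' : Γ.Adj x z
    · by_cases hy' : Γ.Adj y z
      · rw [headCoeff_cons_adj hx'] at hx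
        rw [headCoeff_cons_adj hy'] at hy
        exact ih hx hy
      · exact (hy (headCoeff_cons_of_not hyz hy' l)).elim
    · exact (hx (headCoeff_cons_of_not hxz hx' l)).elim

/-- A merge across the junction needs a syllable that reaches the end of `l` and one at the same
vertex that reaches the front of `l'`. -/
theorem Reduced.append {l l' : List (Σ y, G y)} (hl : Reduced Γ l) (hl' : Reduced Γ l')
    (h : ∀ x, headCoeff Γ x l.reverse ≠ 1 → headCoeff Γ x l' = 1) : Reduced Γ (l ++ l') := by
  induction l with
  | nil => exact hl'
  | cons s l ih =>
    obtain ⟨hs, hx, hl⟩ := reduced_cons.1 hl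
    simp only [List.reverse_cons] at h
    rw [List.cons_append]
    refine reduced_cons.2 ⟨hs, ?_, ih hl fun x hx => h x ?_⟩
    · by_cases hadj : ∀ t ∈ l, Γ.Adj s.1 t.1
      · rw [headCoeff_append_of_forall_adj hadj]
        refine h s.1 ?_
        rw [headCoeff_append_of_forall_adj (by simpa using hadj),
          headCoeff_cons_self]
        exact hs
      · rw [headCoeff_append_of_not_forall_adj hadj, hx]
    · rwa [headCoeff_append_of_not_forall_adj]
      exact fun hadj => hx (headCoeff_eq_one_of_forall_adj hadj)

theorem reduced_singleton {x : V} {g : G x} (hg : g ≠ 1) :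
    Reduced Γ [(⟨x, g⟩ : Σ y, G y)] :=
  ⟨hg, rfl, trivial⟩

theorem headCoeff_singleton_eq_one {x y : V} (h : x ≠ y) (g : G y) :
    headCoeff Γ x [(⟨y, g⟩ : Σ y, G y)] = 1 :=
  headCoeff_eq_one_of_forall_ne (by simpa using h.symm)

theorem Reduced.append_singleton {x : V} {g : G x} {l : List (Σ y, G y)} (hl : Reduced Γ l)
    (hg : g ≠ 1) (hx : headCoeff Γ x l.reverse = 1) : Reduced Γ (l ++ [⟨x, g⟩]) := by
  refine hl.append (reduced_singleton hg) fun y hy => headCoeff_singleton_eq_one ?_ g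
  rintro rfl
  exact hy hx

theorem Reduced.reverse {l : List (Σ y, G y)} (hl : Reduced Γ l) : Reduced Γ l.reverse := by
  induction l with
  | nil => exact hl
  | cons s l ih =>
    rw [List.reverse_cons]
    exact (ih hl.2.2).append_singleton hl.1 (by rw [List.reverse_reverse]; exact hl.2.1)

/-- The word which represents the inverse element. -/
def invWord (l : List (Σ y, G y)) : List (Σ y, G y) :=
  (l.map fun s => ⟨s.1, s.2⁻¹⟩).reverse

theorem headCoeff_map_inv (x : V) (l : List (Σ y, G y)) :
    headCoeff Γ x (l.map fun s => ⟨s.1, s.2⁻¹⟩) = (headCoeff Γ x l)⁻¹ := by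
  induction l with
  | nil => simp [headCoeff_nil]
  | cons s l ih =>
    obtain ⟨y, g⟩ := s
    by_cases h : y = x
    · subst h
      rw [List.map_cons, headCoeff_cons_self, headCoeff_cons_self]
    · by_cases h' : Γ.Adj x y <;> simp [headCoeff, h, h', ih]

theorem headCoeff_invWord (x : V) (l : List (Σ y, G y)) :
    headCoeff Γ x (invWord l) = (headCoeff Γ x l.reverse)⁻¹ := by
  rw [invWord, ← List.map_reverse, headCoeff_map_inv]

theorem headCoeff_reverse_invWord (x : V) (l : List (Σ y, G y)) :
    headCoeff Γ x (invWord l).reverse = (headCoeff Γ x l)⁻¹ := by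
  rw [invWord, List.reverse_reverse, headCoeff_map_inv]

theorem Reduced.map_inv {l : List (Σ y, G y)} (hl : Reduced Γ l) :
    Reduced Γ (l.map fun s => (⟨s.1, s.2⁻¹⟩ : Σ y, G y)) := by
  induction l with
  | nil => exact hl
  | cons s l ih =>
    exact ⟨inv_ne_one.2 hl.1, by rw [headCoeff_map_inv, hl.2.1, inv_one], ih hl.2.2⟩

theorem Reduced.invWord {l : List (Σ y, G y)} (hl : Reduced Γ l) : Reduced Γ (invWord l) :=
  hl.map_inv.reverse

theorem wordProd_invWord (l : List (Σ y, G y)) : wordProd Γ (invWord l) = (wordProd Γ l)⁻¹ := by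
  simp [wordProd, invWord, List.prod_inv_reverse, Function.comp_def]

/-! #### Words with a syllable at the same vertex at both ends -/

/-- A syllable of `l` not adjacent to `x` keeps the two outer syllables apart. -/
theorem Reduced.sandwich {x : V} {g k : G x} {l : List (Σ y, G y)} (hl : Reduced Γ l)
    (hg : g ≠ 1) (hk : k ≠ 1) (h : headCoeff Γ x l = 1) (h' : headCoeff Γ x l.reverse = 1)
    (hadj : ¬ ∀ s ∈ l, Γ.Adj x s.1) : Reduced Γ (⟨x, g⟩ :: (l ++ [⟨x, k⟩])) :=
  ⟨hg, by rw [headCoeff_append_of_not_forall_adj hadj, h], hl.append_singleton hk h'⟩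

theorem headCoeff_sandwich_ne_one {x y : V} {g k : G x} {l : List (Σ y, G y)}
    (h : headCoeff Γ y (⟨x, g⟩ :: (l ++ [⟨x, k⟩])) ≠ 1) :
    y = x ∨ Γ.Adj y x ∧ headCoeff Γ y l ≠ 1 := by
  by_cases hyx : x = y
  · exact .inl hyx.symm
  by_cases hadj : Γ.Adj y x
  · rw [headCoeff_cons_adj hadj] at h
    refine .inr ⟨hadj, ?_⟩
    by_cases hl : ∀ s ∈ l, Γ.Adj y s.1
    · rw [headCoeff_append_of_forall_adj hl, headCoeff_cons_adj hadj] at h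
      exact (h rfl).elim
    · rwa [headCoeff_append_of_not_forall_adj hl] at h
  · exact (h (headCoeff_cons_of_not hyx hadj _)).elim

theorem wordProd_sandwich {x : V} (g k : G x) (l : List (Σ y, G y)) :
    wordProd Γ (⟨x, g⟩ :: (l ++ [⟨x, k⟩])) = of Γ g * wordProd Γ l * of Γ k := by
  rw [wordProd_cons, wordProd_append, wordProd_cons, wordProd_nil, mul_one, mul_assoc]

/-! ### Steering both ends of a word by conjugation -/

/-- A reduced word with a syllable at `x` that can be shuffled to the front and one that can be
shuffled to the end, such that all other vertices with this property belong to `F`. -/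
structure EndsAt (Γ : SimpleGraph V) (x : V) (F : Finset V) (l : List (Σ y, G y)) : Prop where
  reduced : Reduced Γ l
  head : headCoeff Γ x l ≠ 1
  tail : headCoeff Γ x l.reverse ≠ 1
  head_mem : ∀ y, headCoeff Γ y l ≠ 1 → y = x ∨ y ∈ F
  tail_mem : ∀ y, headCoeff Γ y l.reverse ≠ 1 → y = x ∨ y ∈ F

theorem Reduced.exists_endsAt {x : V} {l : List (Σ y, G y)} (hl : Reduced Γ l)
    (h : headCoeff Γ x l ≠ 1) (h' : headCoeff Γ x l.reverse ≠ 1) : ∃ F, EndsAt Γ x F l := by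
  classical
  -- All vertices of the word; only finiteness of this set matters for the later induction.
  refine ⟨(l.map Sigma.fst).toFinset, hl, h, h', fun y hy => .inr ?_, fun y hy => .inr ?_⟩
  · simpa using exists_mem_of_headCoeff_ne_one hy
  · simpa using exists_mem_of_headCoeff_ne_one hy

theorem EndsAt.invWord {x : V} {F : Finset V} {l : List (Σ y, G y)} (h : EndsAt Γ x F l) :
    EndsAt Γ x F (invWord l) where
  reduced := h.reduced.invWord
  head := by simpa [headCoeff_invWord] using h.tail
  tail := by simpa [headCoeff_reverse_invWord] using h.head
  head_mem y hy := h.tail_mem y (by simpa [headCoeff_invWord] using hy)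
  tail_mem y hy := h.head_mem y (by simpa [headCoeff_reverse_invWord] using hy)

theorem EndsAt.of_insert [DecidableEq V] {x : V} {F : Finset V} {l : List (Σ y, G y)}
    (h : EndsAt Γ x (insert x F) l) : EndsAt Γ x F l where
  reduced := h.reduced
  head := h.head
  tail := h.tail
  head_mem y hy := by simpa using h.head_mem y hy
  tail_mem y hy := by simpa using h.tail_mem y hy

theorem isConj_wordProd_sandwich {x : V} (g : G x) (l : List (Σ y, G y)) :
    IsConj (wordProd Γ l) (wordProd Γ (⟨x, g⟩ :: (l ++ [⟨x, g⁻¹⟩]))) :=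
  isConj_iff.2 ⟨of Γ g, by rw [wordProd_sandwich, map_inv]⟩

/-- Conjugate by a nontrivial syllable at `y`. An old end survives only if it is adjacent to `y`, so
`x` disappears from the ends and no vertex outside `F` other than `y` appears. -/
theorem EndsAt.exists_of_compl_adj [∀ x, Nontrivial (G x)] {x y : V} {F : Finset V}
    {l : List (Σ y, G y)} (h : EndsAt Γ x F l) (hxy : Γᶜ.Adj x y) :
    ∃ l' : List (Σ y, G y), IsConj (wordProd Γ l) (wordProd Γ l') ∧ EndsAt Γ y F l' := by
  obtain ⟨hne, hnadj⟩ := (SimpleGraph.compl_adj _ _ _).1 hxy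
  obtain ⟨g, hg⟩ := exists_ne (1 : G y)
  have h₁ : headCoeff Γ y l = 1 := by
    by_contra hy
    exact (eq_or_adj_of_headCoeff_ne_one h.head hy).elim hne hnadj
  have h₂ : headCoeff Γ y l.reverse = 1 := by
    by_contra hy
    exact (eq_or_adj_of_headCoeff_ne_one h.tail hy).elim hne hnadj
  obtain ⟨s, hs, rfl⟩ := exists_mem_of_headCoeff_ne_one h.head
  refine ⟨_, isConj_wordProd_sandwich g l,
    h.reduced.sandwich hg (inv_ne_one.2 hg) h₁ h₂ fun hn => hnadj (hn s hs).symm, ?_, ?_, ?_, ?_⟩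
  · rwa [headCoeff_cons_self]
  · rw [List.reverse_cons_append_singleton, headCoeff_cons_self]
    exact inv_ne_one.2 hg
  · intro z hz
    refine (headCoeff_sandwich_ne_one hz).imp_right fun ⟨hzy, hz⟩ => ?_
    refine (h.head_mem z hz).resolve_left ?_
    rintro rfl
    exact hnadj hzy
  · intro z hz
    rw [List.reverse_cons_append_singleton] at hz
    refine (headCoeff_sandwich_ne_one hz).imp_right fun ⟨hzy, hz⟩ => ?_
    refine (h.tail_mem z hz).resolve_left ?_
    rintro rfl
    exact hnadj hzy

theorem EndsAt.exists_of_walk [∀ x, Nontrivial (G x)] {x y : V} (p : Γᶜ.Walk x y) {F : Finset V}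
    {l : List (Σ y, G y)} (h : EndsAt Γ x F l) :
    ∃ l' : List (Σ y, G y), IsConj (wordProd Γ l) (wordProd Γ l') ∧ EndsAt Γ y F l' := by
  induction p generalizing l with
  | nil => exact ⟨l, IsConj.refl _, h⟩
  | cons hadj _ ih =>
    obtain ⟨l₁, hc₁, h₁⟩ := h.exists_of_compl_adj hadj
    obtain ⟨l₂, hc₂, h₂⟩ := ih h₁
    exact ⟨l₂, hc₁.trans hc₂, h₂⟩

/-- Walking in the complement to a vertex `z` of `F` makes `z` the distinguished end, so it can be
dropped from the set of exceptions; leaving `z` then removes it from the ends. Once `F` is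
exhausted, walk to `y`. -/
theorem EndsAt.exists_endsAt_empty [∀ x, Nontrivial (G x)] (hΓ : Γᶜ.Connected) (F : Finset V)
    {x : V} {l : List (Σ y, G y)} (h : EndsAt Γ x F l) (y : V) :
    ∃ l' : List (Σ y, G y), IsConj (wordProd Γ l) (wordProd Γ l') ∧ EndsAt Γ y ∅ l' := by
  classical
  induction F using Finset.induction_on generalizing x l with
  | empty => exact h.exists_of_walk (hΓ.preconnected x y).some
  | insert z F _ ih =>
    obtain ⟨l₁, hc₁, h₁⟩ := h.exists_of_walk (hΓ.preconnected x z).some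
    obtain ⟨l₂, hc₂, h₂⟩ := ih h₁.of_insert
    exact ⟨l₂, hc₁.trans hc₂, h₂⟩

/-- If the word `k m` begins but cannot end at `x`, split the syllable `k`: conjugation by `g` gives
`(g k) m g⁻¹`, with syllables at `x` on both sides. This is where order at least 3 enters. -/
theorem Reduced.exists_isConj_endsAt_of_head {x : V} {l : List (Σ y, G y)} (hl : Reduced Γ l)
    (hx : headCoeff Γ x l ≠ 1) (hcard : 3 ≤ Cardinal.mk (G x)) :
    ∃ (F : Finset V) (l' : List (Σ y, G y)),
      IsConj (wordProd Γ l) (wordProd Γ l') ∧ EndsAt Γ x F l' := by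
  have hshuf := hl.shuffle_consSyllable_removeHead x
  rw [consSyllable_of_ne_one hx] at hshuf
  rw [← hshuf.wordProd_eq]
  have hm := hl.removeHead x
  have hmx := hl.headCoeff_removeHead x
  generalize GraphProduct.removeHead Γ x l = m at *
  generalize headCoeff Γ x l = k at *
  by_cases htail : headCoeff Γ x (⟨x, k⟩ :: m).reverse = 1
  · rw [List.reverse_cons] at htail
    -- Otherwise `k` itself could be shuffled to the end.
    have hadj : ¬ ∀ s ∈ m, Γ.Adj x s.1 := fun hadj => hx <| by
      rwa [headCoeff_append_of_forall_adj (by simpa using hadj), headCoeff_cons_self] at htail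
    rw [headCoeff_append_of_not_forall_adj (by simpa using hadj)] at htail
    -- Avoiding `1` and `k⁻¹` keeps both `g⁻¹` and `g * k` nontrivial.
    obtain ⟨g, hg, hgk⟩ := Cardinal.exists_ne_ne_of_three_le hcard 1 k⁻¹
    have hred : Reduced Γ (⟨x, g * k⟩ :: (m ++ [⟨x, g⁻¹⟩])) :=
      hm.sandwich (fun h => hgk (mul_eq_one_iff_eq_inv.1 h)) (inv_ne_one.2 hg) hmx htail hadj
    obtain ⟨F, hF⟩ := hred.exists_endsAt (x := x)
      (by rw [headCoeff_cons_self]; exact fun h => hgk (mul_eq_one_iff_eq_inv.1 h))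
      (by rw [List.reverse_cons_append_singleton, headCoeff_cons_self]; exact inv_ne_one.2 hg)
    refine ⟨F, _, isConj_iff.2 ⟨of Γ g, ?_⟩, hF⟩
    rw [wordProd_sandwich, wordProd_cons, map_mul, _root_.map_inv]
    group
  · obtain ⟨F, hF⟩ := Reduced.exists_endsAt (x := x) (l := ⟨x, k⟩ :: m) ⟨hx, hmx, hm⟩
      (by rwa [headCoeff_cons_self]) htail
    exact ⟨F, _, IsConj.refl _, hF⟩

theorem Reduced.exists_isConj_endsAt [∀ x, Nontrivial (G x)] (hΓ : Γᶜ.Connected)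
    (hcard : ∃ x, 3 ≤ Cardinal.mk (G x)) {l : List (Σ y, G y)} (hl : Reduced Γ l) (hne : l ≠ []) :
    ∃ (x : V) (F : Finset V) (l' : List (Σ y, G y)),
      IsConj (wordProd Γ l) (wordProd Γ l') ∧ EndsAt Γ x F l' := by
  obtain ⟨v, hv⟩ := hcard
  by_cases hhead : headCoeff Γ v l = 1
  · by_cases htail : headCoeff Γ v l.reverse = 1
    · obtain ⟨s, m, rfl⟩ := List.exists_cons_of_ne_nil hne
      -- On a complement walk from an end of the word to `v`, some step leaves the set of ends.
      -- Conjugating by a syllable at its target works, since the source occurs in the word and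
      -- blocks it.
      obtain ⟨d, -, hd, hd'⟩ := (hΓ.preconnected s.1 v).some.exists_boundary_dart
        {x | headCoeff Γ x (s :: m) ≠ 1 ∨ headCoeff Γ x (s :: m).reverse ≠ 1}
        (.inl (by rw [headCoeff_cons_self]; exact hl.1)) (not_or.2 ⟨not_not.2 hhead, not_not.2 htail⟩)
      simp only [Set.mem_ofPred_eq, not_or, not_not] at hd hd'
      have hmem : ∃ t ∈ s :: m, t.1 = d.fst := by
        rcases hd with hd | hd
        · exact exists_mem_of_headCoeff_ne_one hd
        · obtain ⟨t, ht, htd⟩ := exists_mem_of_headCoeff_ne_one hd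
          exact ⟨t, List.mem_reverse.1 ht, htd⟩
      obtain ⟨t, ht, htd⟩ := hmem
      obtain ⟨g, hg⟩ := exists_ne (1 : G d.snd)
      obtain ⟨F, hF⟩ := (hl.sandwich hg (inv_ne_one.2 hg) hd'.1 hd'.2 fun hadj =>
          ((SimpleGraph.compl_adj _ _ _).1 d.adj).2 (htd ▸ (hadj t ht).symm)).exists_endsAt
        (x := d.snd) (by rwa [headCoeff_cons_self])
        (by rw [List.reverse_cons_append_singleton, headCoeff_cons_self]; exact inv_ne_one.2 hg)
      exact ⟨_, F, _, isConj_wordProd_sandwich g _, hF⟩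
    -- Here the word ends at `v`, so its inverse begins there.
    · obtain ⟨F, l', hc, hF⟩ := hl.invWord.exists_isConj_endsAt_of_head (x := v)
        (by rw [headCoeff_invWord]; exact inv_ne_one.2 htail) hv
      refine ⟨v, F, _, ?_, hF.invWord⟩
      obtain ⟨c, hc⟩ := isConj_iff.1 hc
      rw [wordProd_invWord] at hc
      refine isConj_iff.2 ⟨c, ?_⟩
      rw [wordProd_invWord, ← hc]
      group
  · exact ⟨v, hl.exists_isConj_endsAt_of_head hhead hv⟩

theorem exists_isConj_endsAt_empty [∀ x, Nontrivial (G x)] (hΓ : Γᶜ.Connected)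
    (hcard : ∃ x, 3 ≤ Cardinal.mk (G x)) {a : GraphProduct Γ G} (ha : a ≠ 1) (x : V) :
    ∃ l : List (Σ y, G y), IsConj a (wordProd Γ l) ∧ EndsAt Γ x ∅ l := by
  obtain ⟨l, hl, rfl⟩ := exists_reduced a
  obtain ⟨y, F, l₁, hc₁, h₁⟩ := hl.exists_isConj_endsAt hΓ hcard fun h => ha (h ▸ wordProd_nil)
  obtain ⟨l₂, hc₂, h₂⟩ := h₁.exists_endsAt_empty hΓ F x
  exact ⟨l₂, hc₁.trans hc₂, h₂⟩

theorem EndsAt.headCoeff_append_ne_one {x y : V} {l l' : List (Σ y, G y)} (hl : EndsAt Γ x ∅ l)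
    (hl' : EndsAt Γ y ∅ l') (hne : x ≠ y) :
    Reduced Γ (l ++ l') ∧ headCoeff Γ x (l ++ l') ≠ 1 := by
  refine ⟨hl.reduced.append hl'.reduced fun z hz => ?_, ?_⟩
  · by_contra hz'
    have h₁ := hl.tail_mem z hz
    have h₂ := hl'.head_mem z hz'
    simp only [Finset.notMem_empty, or_false] at h₁ h₂
    exact hne (h₁.symm.trans h₂)
  · rw [headCoeff_append_of_not_forall_adj]
    · exact hl.head
    · exact fun h => hl.head (headCoeff_eq_one_of_forall_adj h)

theorem conjugatesSeparate [Nontrivial V] [∀ x, Nontrivial (G x)] (hΓ : Γᶜ.Connected)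
    (hcard : ∃ x, 3 ≤ Cardinal.mk (G x)) : ConjugatesSeparate (GraphProduct Γ G) := by
  intro a b ha hb
  obtain ⟨x⟩ := hΓ.nonempty
  obtain ⟨y, hxy⟩ := hΓ.preconnected.exists_adj_of_nontrivial x
  obtain ⟨hne, hnadj⟩ := (SimpleGraph.compl_adj _ _ _).1 hxy
  obtain ⟨l, hcl, hl⟩ := exists_isConj_endsAt_empty hΓ hcard ha x
  obtain ⟨m, hcm, hm⟩ := exists_isConj_endsAt_empty hΓ hcard hb y
  obtain ⟨d, hd⟩ := isConj_iff.1 hcl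
  obtain ⟨c, hc⟩ := isConj_iff.1 hcm
  refine ⟨d⁻¹ * c, fun hcomm => ?_⟩
  -- Conjugating by `d` turns the supposed relation into one between the two prepared words.
  have hcomm' : Commute (wordProd Γ l) (wordProd Γ m) := by
    have := hcomm.map (MulAut.conj d).toMonoidHom
    simp only [MulEquiv.toMonoidHom_eq_coe, MonoidHom.coe_coe, MulAut.conj_apply, hd] at this
    rwa [show d * (d⁻¹ * c * b * (d⁻¹ * c)⁻¹) * d⁻¹ = c * b * c⁻¹ by group, hc] at this
  obtain ⟨h₁, hx⟩ := hl.headCoeff_append_ne_one hm hne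
  obtain ⟨h₂, hy⟩ := hm.headCoeff_append_ne_one hl hne.symm
  rw [h₁.headCoeff_eq_of_wordProd_eq h₂ (by rw [wordProd_append, wordProd_append, hcomm'.eq])] at hx
  exact (eq_or_adj_of_headCoeff_ne_one hx hy).elim hne hnadj

end GraphProduct

/-! ### Graph products over graphs with disconnected complement -/

namespace GraphProduct

variable {V : Type u} {Γ : SimpleGraph V} {G : V → Type v} [∀ x, Group (G x)]

theorem hom_ext {H : Type*} [Group H] {f g : GraphProduct Γ G →* H}
    (h : ∀ (x : V) (a : G x), f (of Γ a) = g (of Γ a)) : f = g := by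
  refine MonoidHom.ext fun a => ?_
  induction a using induction_left with
  | one => rw [map_one, map_one]
  | of_mul x a b ih => rw [map_mul, map_mul, h, ih]

open scoped Classical in
/-- The retraction of a graph product onto the subgroup generated by the groups at the vertices
in `A`. -/
noncomputable def retract (Γ : SimpleGraph V) (G : V → Type v) [∀ x, Group (G x)] (A : Set V) :
    GraphProduct Γ G →* GraphProduct Γ G :=
  lift (fun x => if x ∈ A then of Γ else 1) fun x y h a b => by
    by_cases hx : x ∈ A <;> by_cases hy : y ∈ A <;> simp [hx, hy, commute_of h]

theorem retract_of_mem {A : Set V} {x : V} (h : x ∈ A) (a : G x) :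
    retract Γ G A (of Γ a) = of Γ a := by
  rw [retract, lift_of, if_pos h]

theorem retract_of_notMem {A : Set V} {x : V} (h : x ∉ A) (a : G x) :
    retract Γ G A (of Γ a) = 1 := by
  rw [retract, lift_of, if_neg h, MonoidHom.one_apply]

theorem retract_retract (A : Set V) (g : GraphProduct Γ G) :
    retract Γ G A (retract Γ G A g) = retract Γ G A g := by
  refine DFunLike.congr_fun (f := (retract Γ G A).comp (retract Γ G A)) (hom_ext fun x a => ?_) g
  by_cases hx : x ∈ A
  · simp [retract_of_mem hx]
  · simp [retract_of_notMem hx]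

theorem retract_retract_of_disjoint {A B : Set V} (h : Disjoint A B) (g : GraphProduct Γ G) :
    retract Γ G A (retract Γ G B g) = 1 := by
  refine DFunLike.congr_fun (f := (retract Γ G A).comp (retract Γ G B)) (g := 1)
    (hom_ext fun x a => ?_) g
  by_cases hx : x ∈ B
  · simp [retract_of_mem hx, retract_of_notMem (Set.disjoint_right.1 h hx)]
  · simp [retract_of_notMem hx]

/-- With `A` and its complement this makes the two retractions the projections of an internal direct
product. -/
theorem commute_retract {A B : Set V} (h : ∀ x ∈ A, ∀ y ∈ B, Γ.Adj x y)
    (g k : GraphProduct Γ G) : Commute (retract Γ G A g) (retract Γ G B k) := by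
  induction g using induction_left with
  | one => rw [map_one]; exact Commute.one_left _
  | of_mul x a g ih =>
    rw [map_mul]
    refine Commute.mul_left ?_ ih
    clear ih
    by_cases hx : x ∈ A
    · rw [retract_of_mem hx]
      induction k using induction_left with
      | one => rw [map_one]; exact Commute.one_right _
      | of_mul y b k ih =>
        rw [map_mul]
        refine Commute.mul_right ?_ ih
        by_cases hy : y ∈ B
        · rw [retract_of_mem hy]
          exact commute_of (h x hx y hy) a b
        · rw [retract_of_notMem hy]
          exact Commute.one_right _
    · rw [retract_of_notMem hx]
      exact Commute.one_left _

theorem retract_mul_retract_compl {A : Set V} (h : ∀ x ∈ A, ∀ y ∈ Aᶜ, Γ.Adj x y)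
    (g : GraphProduct Γ G) : retract Γ G A g * retract Γ G Aᶜ g = g := by
  induction g using induction_left with
  | one => simp
  | of_mul x a g ih =>
    rw [map_mul, map_mul, mul_assoc, ← mul_assoc (retract Γ G A g),
      (commute_retract h g (of Γ a)).eq]
    by_cases hx : x ∈ A
    · have hx' : x ∉ Aᶜ := fun h => h hx
      rw [retract_of_mem hx, retract_of_notMem hx', one_mul, ih]
    · rw [retract_of_notMem hx, retract_of_mem (A := Aᶜ) hx, one_mul, mul_assoc, ih]

theorem exists_adj_of_not_connected_compl [Nonempty V] (h : ¬ Γᶜ.Connected) :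
    ∃ A : Set V, A.Nonempty ∧ Aᶜ.Nonempty ∧ ∀ x ∈ A, ∀ y ∈ Aᶜ, Γ.Adj x y := by
  have h' : ¬ Γᶜ.Preconnected := fun hp => h ⟨hp⟩
  simp only [SimpleGraph.Preconnected, not_forall] at h'
  obtain ⟨x, y, hxy⟩ := h'
  -- A connected component of the complement: vertices in different components are adjacent in `Γ`.
  refine ⟨{z | Γᶜ.Reachable x z}, ⟨x, .refl x⟩, ⟨y, hxy⟩, fun z hz t ht => ?_⟩
  by_contra hn
  refine ht (SimpleGraph.Reachable.trans hz (SimpleGraph.Adj.reachable ?_))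
  refine (SimpleGraph.compl_adj _ _ _).2 ⟨?_, hn⟩
  rintro rfl
  exact ht hz

end GraphProduct

/-! ### Direct products do not recognize coordinates -/

section swapFactor

variable {H : Type u} [Group H] (p q : H →* H)

/-- For endomorphisms `p` and `q` with commuting ranges, the endomorphism of the square of a group
which combines the image under `p` of one coordinate with the image under `q` of the other. -/
def swapFactor (hpq : ∀ g h, Commute (p g) (q h)) :
    (ULift.{w} Bool → H) →* (ULift.{w} Bool → H) where
  toFun a i := p (a i) * q (a ⟨!i.down⟩)
  map_one' := by
    funext i
    simp
  map_mul' a b := by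
    funext i
    simp only [Pi.mul_apply, map_mul]
    exact (hpq (b i) (a ⟨!i.down⟩)).mul_mul_mul_comm _ _

theorem swapFactor_swapFactor (hpq : ∀ g h, Commute (p g) (q h)) (hpp : ∀ g, p (p g) = p g)
    (hqq : ∀ g, q (q g) = q g) (hp : ∀ g, p (q g) = 1) (hq : ∀ g, q (p g) = 1)
    (hmul : ∀ g, p g * q g = g) (a : ULift.{w} Bool → H) :
    swapFactor p q hpq (swapFactor p q hpq a) = a := by
  funext i
  simp [swapFactor, hpp, hqq, hp, hq, hmul]

end swapFactor

theorem mem_bot_ideal {ι : Type w} {A : Set ι} : A ∈ (⊥ : Order.Ideal (Set ι)) ↔ A = ∅ :=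
  ⟨fun h => Set.subset_empty_iff.1 h, fun h => h ▸ (⊥ : Order.Ideal (Set ι)).bot_mem⟩

theorem reducedCon_bot {ι : Type w} {M : ι → Type u} [∀ i, Group (M i)] {a b : ∀ i, M i} :
    reducedCon ⊥ M a b ↔ a = b := by
  refine mem_bot_ideal.trans ?_
  rw [Set.eq_empty_iff_forall_notMem, funext_iff]
  exact forall_congr' fun i => not_not

theorem ReducedProduct.proj_bot_eq_one_iff {ι : Type w} {M : ι → Type u} [∀ i, Group (M i)]
    (S : Set ι) (a : ∀ i, M i) :
    proj ⊥ M S (a : ReducedProduct ⊥ M) = proj ⊥ M S 1 ↔ ∀ i ∈ S, a i = 1 := by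
  rw [eq_comm, proj_eq_proj_iff, inv_one, one_mul, supp_coe, disjoint_mk, mem_bot_ideal,
    Set.eq_empty_iff_forall_notMem]
  refine forall_congr' fun i => ?_
  rw [Set.mem_inter_iff, not_and']
  exact imp_congr_right fun _ => not_not

/-- Exchanging the `q`-parts spreads an element supported at `false` over both coordinates: `p g` at
`false` and `q g` at `true`. Such elements vanish under the projection to `true`, so their images
must vanish on the set `T` assigned to `true`. Hence `T` is empty, although `α` is injective. -/
theorem not_groupRecognizesCoordinates {H : Type u} [Group H] (p q : H →* H)
    (hpq : ∀ g h, Commute (p g) (q h)) (hpp : ∀ g, p (p g) = p g)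
    (hqq : ∀ g, q (q g) = q g) (hp : ∀ g, p (q g) = 1) (hq : ∀ g, q (p g) = 1)
    (hmul : ∀ g, p g * q g = g) (hp' : ∃ g, p g ≠ 1) (hq' : ∃ g, q g ≠ 1) :
    ¬ GroupRecognizesCoordinates.{u, w} H := by
  classical
  intro hrec
  have hinv := swapFactor_swapFactor.{u, w} p q hpq hpp hqq hp hq hmul
  let e : (ULift.{w} Bool → H) ≃* (ULift.{w} Bool → H) :=
    { swapFactor p q hpq with
      invFun := swapFactor p q hpq
      left_inv := hinv
      right_inv := hinv }
  let Φ : ReducedProduct ⊥ (fun _ : ULift.{w} Bool => H) ≃*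
      ReducedProduct ⊥ (fun _ : ULift.{w} Bool => H) :=
    Con.congr e <| Con.ext fun a b => by
      rw [Con.comap_rel, reducedCon_bot, reducedCon_bot]
      exact e.injective.eq_iff.symm
  have huniv : (Set.univ : Set (ULift.{w} Bool)) ∉ (⊥ : Order.Ideal (Set (ULift.{w} Bool))) :=
    fun h => Set.univ_nonempty.ne_empty (mem_bot_ideal.1 h)
  obtain ⟨α, hα⟩ := hrec (ULift.{w} Bool) (ULift.{w} Bool) ⊥ ⊥ huniv huniv
    (fun _ => GrpCat.of H) (fun _ => GrpCat.of H) (fun _ => ⟨MulEquiv.refl H⟩)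
    (fun _ => ⟨MulEquiv.refl H⟩) Φ
  obtain ⟨T, hT⟩ : ∃ T, α (PowersetMod.mk ⊥ {⟨true⟩}) = PowersetMod.mk ⊥ T :=
    (Quotient.exists_rep _).imp fun _ => Eq.symm
  obtain ⟨Ψ, hΨ⟩ := hα _ T hT
  have key : ∀ g : H, ∀ i ∈ T, swapFactor.{u, w} p q hpq (Pi.mulSingle ⟨false⟩ g) i = 1 := by
    intro g
    rw [← ReducedProduct.proj_bot_eq_one_iff (M := fun _ => H)]
    have h₁ := hΨ ((Pi.mulSingle ⟨false⟩ g : ULift.{w} Bool → H) :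
      ReducedProduct ⊥ (fun _ : ULift.{w} Bool => H))
    have h₂ := hΨ 1
    rw [(ReducedProduct.proj_bot_eq_one_iff (M := fun _ => H) _ _).2 (by
      rintro i rfl
      simp), h₂, map_one Φ] at h₁
    exact h₁.symm
  have hTempty : T = ∅ := by
    refine Set.eq_empty_iff_forall_notMem.2 fun i hi => ?_
    obtain ⟨⟨⟩ | ⟨⟩⟩ := i
    · obtain ⟨g, hg⟩ := hp'
      refine hg ?_
      simpa [swapFactor, Pi.mulSingle_apply] using key g _ hi
    · obtain ⟨g, hg⟩ := hq'
      refine hg ?_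
      simpa [swapFactor, Pi.mulSingle_apply] using key g _ hi
  rw [hTempty, ← PowersetMod.bot_def, map_eq_bot_iff, PowersetMod.bot_def,
    PowersetMod.mk_eq_mk_iff, Set.sdiff_empty, mem_bot_ideal] at hT
  exact (Set.singleton_ne_empty _) hT.1

theorem GraphProduct.not_groupRecognizesCoordinates {V : Type u} {Γ : SimpleGraph V}
    {G : V → Type v} [∀ x, Group (G x)] [Nonempty V] [∀ x, Nontrivial (G x)]
    (h : ¬ Γᶜ.Connected) : ¬ GroupRecognizesCoordinates.{max u v, w} (GraphProduct Γ G) := by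
  obtain ⟨A, ⟨x, hx⟩, ⟨y, hy⟩, hA⟩ := exists_adj_of_not_connected_compl h
  obtain ⟨a, ha⟩ := exists_ne (1 : G x)
  obtain ⟨b, hb⟩ := exists_ne (1 : G y)
  exact _root_.not_groupRecognizesCoordinates (retract Γ G A) (retract Γ G Aᶜ)
    (commute_retract hA) (retract_retract A) (retract_retract Aᶜ)
    (retract_retract_of_disjoint disjoint_compl_right)
    (retract_retract_of_disjoint disjoint_compl_left) (retract_mul_retract_compl hA)
    ⟨of Γ a, by rw [retract_of_mem hx]; exact of_ne_one ha⟩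
    ⟨of Γ b, by rw [retract_of_mem hy]; exact of_ne_one hb⟩

/-! ### Graph products recognizing coordinates -/

theorem GraphProduct.nontrivial {V : Type u} (Γ : SimpleGraph V) (G : V → Type v)
    [∀ x, Group (G x)] [Nonempty V] [∀ x, Nontrivial (G x)] : Nontrivial (GraphProduct Γ G) := by
  obtain ⟨x⟩ := ‹Nonempty V›
  obtain ⟨a, ha⟩ := exists_ne (1 : G x)
  exact ⟨_, _, of_ne_one (Γ := Γ) ha⟩

theorem classRecognizesCoordinates_of_conjugatesSeparate {C : Set GrpCat.{u}}
    (hC : ∀ H ∈ C, Nontrivial H ∧ ConjugatesSeparate H) :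
    ClassRecognizesCoordinates.{u, w} C := by
  intro ι κ 𝓘 𝓙 _ _ M N hM hN Φ
  have := fun i => (hC _ (hM i)).1
  have := fun j => (hC _ (hN j)).1
  exact isomorphicallyCoordinateRespecting_of_conjugatesSeparate
    (fun i => (hC _ (hM i)).2) (fun j => (hC _ (hN j)).2) Φ

theorem ClassRecognizesCoordinates.mono {C D : Set GrpCat.{u}}
    (hD : ClassRecognizesCoordinates.{u, w} D) (h : C ⊆ D) :
    ClassRecognizesCoordinates.{u, w} C :=
  fun ι κ 𝓘 𝓙 h𝓘 h𝓙 M N hM hN => hD ι κ 𝓘 𝓙 h𝓘 h𝓙 M N (fun i => h (hM i)) fun j => h (hN j)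

theorem classRecognizesCoordinates_connectedGraphProducts :
    ClassRecognizesCoordinates.{max u v, w} connectedGraphProducts.{u, v} := by
  refine classRecognizesCoordinates_of_conjugatesSeparate ?_
  rintro H ⟨V, Γ, G, _, hV, hG, hcard, hΓ, ⟨e⟩⟩
  have := GraphProduct.nontrivial Γ G
  exact ⟨e.toEquiv.nontrivial, .of_mulEquiv e (GraphProduct.conjugatesSeparate hΓ hcard)⟩

theorem theorem4p17 :
    (∀ (V : Type u) (Γ : SimpleGraph V) (G : V → Type v) [∀ x, Group (G x)],
      Nontrivial V → (∀ x, Nontrivial (G x)) → (∃ x, 3 ≤ Cardinal.mk (G x)) →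
        (GroupRecognizesCoordinates.{max u v, w} (GraphProduct Γ G) ↔ Γᶜ.Connected)) ∧
    ClassRecognizesCoordinates.{max u v, w} connectedGraphProducts.{u, v} := by
  refine ⟨fun V Γ G _ hV hG hcard => ⟨fun h => ?_, fun h => ?_⟩,
    classRecognizesCoordinates_connectedGraphProducts⟩
  · by_contra hn
    exact GraphProduct.not_groupRecognizesCoordinates hn h
  · exact classRecognizesCoordinates_connectedGraphProducts.mono
      fun H hH => ⟨V, Γ, G, inferInstance, hV, hG, hcard, h, hH⟩
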